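/- Let $k\ge 0$ and $m\ge 1$ be integers. Let $M_m\subset\mathbb R^{2^m}$ be the balanced Barnes–Wall lattice, i.e. the $\mathbb Z[\sqrt2]$-span of the rows of the $m$-fold Kronecker power of the matrix $\begin{pmatrix}\sqrt2&0\\1&1\end{pmatrix}$, with the $2^m$ coordinates indexed by $\mathbb F_2^m$, and let $\mathcal C_m=\{g\in O(2^m,\mathbb R): gM_m=M_m\}$ be the (real) Clifford group. Fix a basis of $\mathrm{GF}(2^m)$ over $\mathbb F_2$ and use it to identify $\mathrm{GF}(2^m)$ with $\mathbb F_2^m$. For a binary linear code $C$ of length $2k$, the complete weight enumerator of $C\otimes\mathrm{GF}(2^m)$ (the $\mathrm{GF}(2^m)$-span of $C$ in $\mathrm{GF}(2^m)^{2k}$) is the polynomial $\sum_{c\in C\otimes \mathrm{GF}(2^m)}\prod_{i=1}^{2k}x_{c_i}$ in the $2^m$ variables $x_a$, $a\in\mathrm{GF}(2^m)$. Two codes are equivalent if they differ by a permutation of the coordinate positions. Then the space of real homogeneous polynomials of degree $2k$ in $2^m$ variables that are invariant under $\mathcal C_m$ is spanned by the complete weight enumerators of the codes $C\otimes\mathrm{GF}(2^m)$,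 where $C$ ranges over all binary self-dual codes of length $2k$. If $m\ge k-1$, then these complete weight enumerators, one for each equivalence class of binary self-dual codes of length $2k$, form a basis of this space. -/

import Mathlib

open MvPolynomial Matrix Module

namespace CliffordInvariants

/-- The ring `ℤ[√2] ⊂ ℝ`. -/
noncomputable abbrev ZSqrtTwo : Subalgebra ℤ ℝ := Algebra.adjoin ℤ {Real.sqrt 2}

/-- The generator matrix `G₁`, with rows `(√2, 0)` and `(1, 1)`; rows and columns are indexed by
`0, 1 ∈ 𝔽₂`. -/
noncomputable def genOne : Matrix (ZMod 2) (ZMod 2) ℝ :=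
  Matrix.of fun i j => if i = 0 then (if j = 0 then Real.sqrt 2 else 0) else 1

/-- The `m`-fold Kronecker power `G_m = G₁ ⊗ ⋯ ⊗ G₁`; the `2 ^ m` coordinates are indexed by
`𝔽₂^m`. -/
noncomputable def gen (m : ℕ) : Matrix (Fin m → ZMod 2) (Fin m → ZMod 2) ℝ :=
  Matrix.of fun u v => ∏ t, genOne (u t) (v t)

/-- The balanced Barnes-Wall lattice `M_m`: the `ℤ[√2]`-span of the rows of `G_m`. -/
noncomputable def balancedBarnesWall (m : ℕ) :
    Submodule ZSqrtTwo ((Fin m → ZMod 2) → ℝ) :=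
  Submodule.span ZSqrtTwo (Set.range fun u => (gen m).row u)

/-- The Clifford group `𝒞_m = Aut(M_m)`: the subgroup of `O(2 ^ m, ℝ)` of all `g` with
`g M_m = M_m`. -/
noncomputable def cliffordGroup (m : ℕ) :
    Subgroup (Matrix.orthogonalGroup (Fin m → ZMod 2) ℝ) where
  carrier := {g | ∀ v : (Fin m → ZMod 2) → ℝ,
    (g : Matrix (Fin m → ZMod 2) (Fin m → ZMod 2) ℝ) *ᵥ v ∈ balancedBarnesWall m ↔
      v ∈ balancedBarnesWall m}
  one_mem' := by
    intro v
    simp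
  mul_mem' := by
    intro g h hg hh v
    have := hg ((h : Matrix (Fin m → ZMod 2) (Fin m → ZMod 2) ℝ) *ᵥ v)
    rw [Matrix.mulVec_mulVec] at this
    exact this.trans (hh v)
  inv_mem' := by
    intro g hg v
    have key : (g : Matrix (Fin m → ZMod 2) (Fin m → ZMod 2) ℝ) *
        ((g⁻¹ : Matrix.orthogonalGroup (Fin m → ZMod 2) ℝ) :
          Matrix (Fin m → ZMod 2) (Fin m → ZMod 2) ℝ) = 1 :=
      congrArg Subtype.val (mul_inv_cancel g)
    have := hg (((g⁻¹ : Matrix.orthogonalGroup (Fin m → ZMod 2) ℝ) :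
          Matrix (Fin m → ZMod 2) (Fin m → ZMod 2) ℝ) *ᵥ v)
    rw [Matrix.mulVec_mulVec, key, Matrix.one_mulVec] at this
    exact this.symm

/-- The linear substitution `x_u ↦ ∑_v A_{u v} x_v` on real polynomials. -/
noncomputable def subst {V : Type*} [Fintype V] (A : Matrix V V ℝ) :
    MvPolynomial V ℝ →ₐ[ℝ] MvPolynomial V ℝ :=
  aeval fun u => ∑ v, C (A u v) * X v

/-- The space of homogeneous polynomials of degree `d` in `2 ^ m` variables, with real
coefficients, that are fixed by every element of `𝒞_m`. -/
noncomputable def homogeneousInvariants (m d : ℕ) :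
    Submodule ℝ (MvPolynomial (Fin m → ZMod 2) ℝ) where
  carrier := {p | p.IsHomogeneous d ∧ ∀ g ∈ cliffordGroup m,
    subst (g : Matrix (Fin m → ZMod 2) (Fin m → ZMod 2) ℝ) p = p}
  zero_mem' := ⟨isHomogeneous_zero _ _ _, fun _ _ => map_zero _⟩
  add_mem' := fun hp hq => ⟨hp.1.add hq.1, fun g hg => by rw [map_add, hp.2 g hg, hq.2 g hg]⟩
  smul_mem' := fun c p hp =>
    ⟨(homogeneousSubmodule _ ℝ d).smul_mem c hp.1, fun g hg => by rw [map_smul, hp.2 g hg]⟩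

/-- A binary linear code of length `n` is self-dual if it equals its orthogonal complement for the
standard form `∑ i, v i * w i`. -/
def IsSelfDual {n : ℕ} (D : Submodule (ZMod 2) (Fin n → ZMod 2)) : Prop :=
  ∀ v, v ∈ D ↔ ∀ w ∈ D, v ⬝ᵥ w = 0

/-- The binary self-dual codes of length `n`. -/
abbrev SelfDualCode (n : ℕ) : Type :=
  {D : Submodule (ZMod 2) (Fin n → ZMod 2) // IsSelfDual D}

/-- Equivalence of binary self-dual codes: `E` arises from `D` by a permutation of the
coordinate positions. -/
instance codeSetoid (n : ℕ) : Setoid (SelfDualCode n) where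
  r D E := ∃ σ : Equiv.Perm (Fin n), ∀ v : Fin n → ZMod 2, v ∈ E.1 ↔ v ∘ σ ∈ D.1
  iseqv :=
    { refl := fun _ => ⟨1, fun _ => Iff.rfl⟩
      symm := by
        rintro D E ⟨σ, h⟩
        refine ⟨σ⁻¹, fun v => ?_⟩
        rw [h]
        have : (v ∘ ⇑σ⁻¹) ∘ ⇑σ = v := by
          funext i
          simp
        rw [this]
      trans := by
        rintro D E F ⟨σ, h⟩ ⟨τ, h'⟩
        exact ⟨τ * σ, fun v => (h' v).trans (h _)⟩ }

/-- The code `D ⊗ F` of length `n` over an extension `F` of `𝔽₂`: the `F`-span in `F ^ n` of the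
codewords of `D`. -/
def extendScalars (F : Type*) [Field F] [Algebra (ZMod 2) F] {n : ℕ}
    (D : Submodule (ZMod 2) (Fin n → ZMod 2)) : Submodule F (Fin n → F) :=
  Submodule.span F ((fun c i => algebraMap (ZMod 2) F (c i)) '' (D : Set (Fin n → ZMod 2)))

/-- The complete weight enumerator `∑_{c ∈ E} ∏ i, x_{c i}` of a linear code `E` over a finite
field `F`, in variables `x_a` (`a ∈ F`). -/
noncomputable def completeWeightEnumerator {F : Type*} [Field F] [Finite F] {n : ℕ}
    (E : Submodule F (Fin n → F)) : MvPolynomial F ℝ :=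
  ∑ c ∈ (Set.toFinite (E : Set (Fin n → F))).toFinset, ∏ i, X (c i)

/-- The complete weight enumerator of `D ⊗ GF(2 ^ m)`, where the variable `x_a`,
`a ∈ GF(2 ^ m)`, is indexed by the coordinate vector of `a` in the basis `b` over `𝔽₂`. -/
noncomputable def cwe {m : ℕ} (b : Basis (Fin m) (ZMod 2) (GaloisField 2 m)) {n : ℕ}
    (D : SelfDualCode n) : MvPolynomial (Fin m → ZMod 2) ℝ :=
  rename b.equivFun (completeWeightEnumerator (extendScalars (GaloisField 2 m) D.1))

end CliffordInvariants

namespace CliffordInvariants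

/-! The proof joins a determination of the Clifford group with a triangularity argument on tensors.

The group. Over ℤ[√2] the lattice is closed under pointwise multiplication: it is generated as an
algebra by the functions √2·1_{v_t = 0}. Hence affine permutations of 𝔽₂^m and signs (-1)^f with f
quadratic preserve it, and so does the Hadamard matrix in each tensor factor, which permutes the
generating rows. Conversely, products of these matrices move every minimal vector to the frame
vector √2^m e_0 (`reach_of_nrm`). A Clifford matrix fixing that vector permutes the frame up to
signs, because frame vectors are the only minimal vectors congruent to it modulo √2, up to sign;
sums over flats then force the permutation to be affine and the signs to be quadratic
(`gen_of_fix`). So invariance need only be tested on the generators.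

The invariants. A homogeneous polynomial of degree n is a symmetric function on words (z_1, …, z_n)
of vectors in 𝔽₂^m, seen also as m binary rows of length n, and the weight enumerator of C ⊗ GF(2^m)
is the indicator of "all rows lie in C" (`cwe_eq`). Affine permutations and quadratic signs leave
only combinations of such indicators for self-orthogonal codes containing the all-ones word
(`mem_span_codeInd`). The Hadamard operator, averaged over GL_m(𝔽₂), sends the indicator of D to a
multiple of itself plus indicators of codes of dimension one more. Its diagonal coefficient differs
from the eigenvalue |GL_m(𝔽₂)| of an invariant unless D is self-dual (`diagCoeff_ne`), so climbing
in dimension leaves only self-dual codes (`mem_codeSpan_of_gen`).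

Independence. If k ≤ m + 1, every self-dual code D is generated by the all-ones word and m rows. The
monomial of the resulting word occurs in the enumerator of E exactly when E is equivalent to D
(`coeff_cwe_ne_zero_iff`). -/

/-- Binary vectors of length `m`. -/
abbrev Vec (m : ℕ) : Type := Fin m → ZMod 2

/-! ### The lattice over ℤ[√2] as a ring of functions. -/

/-- The ring `ℤ[√2]` as an abstract quadratic ring. -/
abbrev ZS : Type := Zsqrtd 2

/-- The generator matrix of the two-dimensional lattice, with entries in `ZS`. -/
def genZ (i j : ZMod 2) : ZS := if i = 0 then (if j = 0 then Zsqrtd.sqrtd else 0) else 1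

/-- Rows of the Kronecker power of `genZ`. -/
def rowZ {m : ℕ} (u : Vec m) : Vec m → ZS := fun v => ∏ t, genZ (u t) (v t)

theorem sqrtd_mul_self : (Zsqrtd.sqrtd : ZS) * Zsqrtd.sqrtd = 2 := by decide

theorem zmod_two_cases (a : ZMod 2) : a = 0 ∨ a = 1 := by revert a; decide

/-- Row 0 is √2 times an indicator function, so its square is √2 times itself, and row 1 is the
unit. This makes the lattice a ring. -/
theorem genZ_mul (a b c : ZMod 2) :
    genZ a c * genZ b c = (if a = 0 ∧ b = 0 then Zsqrtd.sqrtd else 1) * genZ (a * b) c := by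
  revert a b c; decide

theorem rowZ_mul {m : ℕ} (u u' : Vec m) :
    rowZ u * rowZ u' =
      (∏ t, (if u t = 0 ∧ u' t = 0 then (Zsqrtd.sqrtd : ZS) else 1)) • rowZ (u * u') := by
  funext v
  simp only [rowZ, Pi.mul_apply, Pi.smul_apply, smul_eq_mul, ← Finset.prod_mul_distrib, genZ_mul]

theorem rowZ_one {m : ℕ} : rowZ (1 : Vec m) = 1 := by
  funext v
  simp [rowZ, genZ]

/-- The `ZS`-span of the rows `rowZ u`; it is closed under pointwise multiplication. -/
def lat (m : ℕ) : Subalgebra ZS (Vec m → ZS) :=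
  (Submodule.span ZS (Set.range (rowZ (m := m)))).toSubalgebra
    (rowZ_one (m := m) ▸ Submodule.subset_span ⟨1, rfl⟩)
    (by
      intro x y hx hy
      refine Submodule.span_induction₂ (p := fun x y _ _ =>
        x * y ∈ Submodule.span ZS (Set.range (rowZ (m := m)))) ?_ ?_ ?_ ?_ ?_ ?_ ?_ hx hy
      · rintro _ _ ⟨u, rfl⟩ ⟨u', rfl⟩
        rw [rowZ_mul]
        exact Submodule.smul_mem _ _ (Submodule.subset_span ⟨_, rfl⟩)
      · intro y _; simp
      · intro x _; simp
      · intro x y z _ _ _ h1 h2; rw [add_mul]; exact add_mem h1 h2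
      · intro x y z _ _ _ h1 h2; rw [mul_add]; exact add_mem h1 h2
      · intro r x y _ _ h; rw [smul_mul_assoc]; exact Submodule.smul_mem _ _ h
      · intro r x y _ _ h; rw [mul_smul_comm]; exact Submodule.smul_mem _ _ h)

theorem rowZ_mem_lat {m : ℕ} (u : Vec m) : rowZ u ∈ lat m :=
  Submodule.subset_span ⟨u, rfl⟩

theorem lat_induction {m : ℕ} {p : (Vec m → ZS) → Prop} (row : ∀ u, p (rowZ u)) (zero : p 0)
    (add : ∀ x y, x ∈ lat m → y ∈ lat m → p x → p y → p (x + y))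
    (smul : ∀ (r : ZS) x, x ∈ lat m → p x → p (r • x)) {x : Vec m → ZS} (hx : x ∈ lat m) : p x := by
  refine Submodule.span_induction (p := fun x _ => p x) ?_ zero (fun x y hx hy => add x y hx hy)
    (fun r x hx => smul r x hx) hx
  rintro _ ⟨u, rfl⟩
  exact row u

/-- `√2` at `0` and `0` at `1`. -/
def zeroVal (a : ZMod 2) : ZS := if a = 0 then Zsqrtd.sqrtd else 0

theorem zeroVal_add_one_sub (b : ZMod 2) : zeroVal (b + 1) - zeroVal b =
    Zsqrtd.sqrtd * (1 - Zsqrtd.sqrtd * zeroVal b) := by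
  revert b; decide

/-- `√2` times the indicator function of the zero set of `f`. -/
def zeroInd {m : ℕ} (f : Vec m → ZMod 2) : Vec m → ZS := fun v => zeroVal (f v)

/-- With `zeroInd_coord_mem` this shows that the functions √2·1_{v_t = 0} generate `lat m` as an
algebra. -/
theorem rowZ_eq_prod {m : ℕ} (u : Vec m) :
    rowZ u = ∏ t, (if u t = 0 then zeroInd (fun v => v t) else 1) := by
  funext v
  simp only [rowZ, Finset.prod_apply]
  refine Finset.prod_congr rfl fun t _ => ?_
  by_cases h : u t = 0 <;> simp [genZ, zeroInd, zeroVal, h]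

theorem zeroInd_coord_mem {m : ℕ} (t : Fin m) : zeroInd (fun v => v t) ∈ lat m := by
  have : zeroInd (fun v : Vec m => v t) = rowZ (Function.update 1 t 0) := by
    rw [rowZ_eq_prod, Finset.prod_eq_single t]
    · simp
    · intro s _ hs; simp [Function.update_of_ne hs]
    · simp
  rw [this]
  exact rowZ_mem_lat _

theorem sqrtd_smul_mem {m : ℕ} {x : Vec m → ZS} (hx : x ∈ lat m) :
    (Zsqrtd.sqrtd : ZS) • x ∈ lat m := (lat m).smul_mem hx _

/-- This is √2 times the identity 1_{a=b} = 1 - 1_{a=0} - 1_{b=0} + 2·1_{a=0}·1_{b=0}; the factor 2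
is absorbed by the two factors √2 in the product. -/
theorem zeroInd_add {m : ℕ} (f g : Vec m → ZMod 2) :
    zeroInd (f + g) = (Zsqrtd.sqrtd : ZS) • 1 - zeroInd f - zeroInd g
      + (Zsqrtd.sqrtd : ZS) • (zeroInd f * zeroInd g) := by
  funext v
  simp only [zeroInd, Pi.add_apply, Pi.sub_apply, Pi.smul_apply, Pi.mul_apply, Pi.one_apply]
  generalize f v = a
  generalize g v = b
  revert a b; decide

/-! ### Affine substitutions and sums over flats. -/

/-- Functions on `𝔽₂^m` that are polynomials of degree at most one. -/
def affFun (m : ℕ) : Submodule (ZMod 2) (Vec m → ZMod 2) :=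
  Submodule.span (ZMod 2) (insert 1 (Set.range fun t v => v t))

theorem one_mem_affFun {m : ℕ} : (1 : Vec m → ZMod 2) ∈ affFun m :=
  Submodule.subset_span (Set.mem_insert _ _)

theorem coord_mem_affFun {m : ℕ} (t : Fin m) : (fun v => v t) ∈ affFun m :=
  Submodule.subset_span (Set.mem_insert_of_mem _ ⟨t, rfl⟩)

theorem zeroInd_mem_lat {m : ℕ} {f : Vec m → ZMod 2} (hf : f ∈ affFun m) : zeroInd f ∈ lat m := by
  have h0 : zeroInd (0 : Vec m → ZMod 2) ∈ lat m := by
    have : zeroInd (0 : Vec m → ZMod 2) = (Zsqrtd.sqrtd : ZS) • 1 := by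
      funext v; simp [zeroInd, zeroVal]
    rw [this]
    exact sqrtd_smul_mem (one_mem _)
  refine Submodule.span_induction (p := fun f _ => zeroInd f ∈ lat m) ?_ h0 ?_ ?_ hf
  · rintro _ (rfl | ⟨t, rfl⟩)
    · have : zeroInd (1 : Vec m → ZMod 2) = 0 := by
        funext v; simp [zeroInd, zeroVal]
      rw [this]
      exact zero_mem _
    · exact zeroInd_coord_mem t
  · intro f g _ _ hf hg
    rw [zeroInd_add]
    exact add_mem (sub_mem (sub_mem (sqrtd_smul_mem (one_mem _)) hf) hg)
      (sqrtd_smul_mem (mul_mem hf hg))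
  · intro r f _ hf
    rcases zmod_two_cases r with rfl | rfl
    · rwa [zero_smul]
    · rwa [one_smul]

/-- Composition is a ring homomorphism, and it takes the algebra generators to √2-indicators of zero
sets of affine functions. -/
theorem comp_mem_lat {m n : ℕ} {π : Vec m → Vec n} (hπ : ∀ t, (fun v => π v t) ∈ affFun m)
    {x : Vec n → ZS} (hx : x ∈ lat n) : x ∘ π ∈ lat m := by
  refine lat_induction (p := fun x => x ∘ π ∈ lat m) ?_ (zero_mem (lat m))
    (fun x y _ _ h1 h2 => add_mem h1 h2) (fun r x _ h => (lat m).smul_mem h r) hx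
  intro u
  have : rowZ u ∘ π = ∏ t, (if u t = 0 then zeroInd (fun v => π v t) else 1) := by
    funext v
    rw [rowZ_eq_prod]
    simp only [Function.comp_apply, Finset.prod_apply]
    refine Finset.prod_congr rfl fun t _ => ?_
    by_cases h : u t = 0 <;> simp [h, zeroInd]
  rw [this]
  refine prod_mem fun t _ => ?_
  split_ifs
  · exact zeroInd_mem_lat (hπ t)
  · exact one_mem _

theorem translate_mem_affFun {m : ℕ} (a : Vec m) (t : Fin m) :
    (fun v : Vec m => (v + a) t) ∈ affFun m := by
  have : (fun v : Vec m => (v + a) t) = (fun v => v t) + a t • (1 : Vec m → ZMod 2) := by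
    funext v; simp
  rw [this]
  exact add_mem (coord_mem_affFun t) (Submodule.smul_mem _ _ one_mem_affFun)

/-- Translations act trivially on the lattice modulo √2. It suffices to treat products of
generators, and a generator changes by 0 or by √2(1 - √2·generator). -/
theorem exists_translate_sub {m : ℕ} (a : Vec m) {x : Vec m → ZS} (hx : x ∈ lat m) :
    ∃ y ∈ lat m, x ∘ (· + a) - x = (Zsqrtd.sqrtd : ZS) • y := by
  have htr : ∀ {x : Vec m → ZS}, x ∈ lat m → x ∘ (· + a) ∈ lat m :=
    comp_mem_lat (translate_mem_affFun a)
  refine lat_induction (p := fun x => ∃ y ∈ lat m, x ∘ (· + a) - x = (Zsqrtd.sqrtd : ZS) • y)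
    ?_ ⟨0, zero_mem _, by funext v; simp⟩ ?_ ?_ hx
  · intro u
    rw [rowZ_eq_prod]
    have key : ∀ s : Finset (Fin m), (∏ t ∈ s, (if u t = 0 then zeroInd (fun v => v t) else 1)) ∈ lat m ∧
        ∃ y ∈ lat m,
        (∏ t ∈ s, (if u t = 0 then zeroInd (fun v => v t) else 1)) ∘ (· + a)
        - (∏ t ∈ s, (if u t = 0 then zeroInd (fun v => v t) else 1)) = (Zsqrtd.sqrtd : ZS) • y := by
      intro s
      induction s using Finset.induction_on with
      | empty => exact ⟨by simp [one_mem], 0, zero_mem _, by funext v; simp⟩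
      | insert t s hts ih =>
        obtain ⟨hmem, y, hy, hxy⟩ := ih
        rw [Finset.prod_insert hts]
        set z := ∏ t ∈ s, (if u t = 0 then zeroInd (fun v : Vec m => v t) else 1) with hz
        by_cases hu : u t = 0
        · rw [if_pos hu]
          refine ⟨mul_mem (zeroInd_coord_mem t) hmem, ?_⟩
          have h1 : ∃ w ∈ lat m, zeroInd (fun v : Vec m => v t) ∘ (· + a) - zeroInd (fun v => v t)
              = (Zsqrtd.sqrtd : ZS) • w := by
            rcases zmod_two_cases (a t) with h | h
            · exact ⟨0, zero_mem _, by funext v; simp [zeroInd, h]⟩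
            · refine ⟨1 - (Zsqrtd.sqrtd : ZS) • zeroInd (fun v => v t), sub_mem (one_mem _)
                (sqrtd_smul_mem (zeroInd_coord_mem t)), ?_⟩
              funext v
              simp only [zeroInd, Function.comp_apply, Pi.add_apply, Pi.sub_apply, Pi.smul_apply,
                Pi.one_apply, h, smul_eq_mul]
              exact zeroVal_add_one_sub _
          obtain ⟨w, hw, hxw⟩ := h1
          -- Twisted Leibniz rule for the difference operator: Δ(xz) = Δx · (z translated) + x · Δz.
          refine ⟨w * (z ∘ (· + a)) + zeroInd (fun v => v t) * y,
            add_mem (mul_mem hw (htr hmem)) (mul_mem (zeroInd_coord_mem t) hy), ?_⟩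
          rw [smul_add, ← smul_mul_assoc, ← hxw, ← mul_smul_comm, ← hxy]
          funext v
          simp only [Function.comp_apply, Pi.mul_apply, Pi.sub_apply, Pi.add_apply]
          ring
        · rw [if_neg hu, one_mul]
          exact ⟨hmem, y, hy, hxy⟩
    exact (key Finset.univ).2
  · rintro x x' _ _ ⟨y, hy, h⟩ ⟨y', hy', h'⟩
    refine ⟨y + y', add_mem hy hy', ?_⟩
    rw [smul_add, ← h, ← h']
    funext v
    simp only [Function.comp_apply, Pi.sub_apply, Pi.add_apply]
    ring
  · rintro r x _ ⟨y, hy, h⟩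
    refine ⟨r • y, (lat m).smul_mem hy r, ?_⟩
    rw [smul_comm, ← h]
    funext v
    simp only [Function.comp_apply, Pi.sub_apply, Pi.smul_apply, smul_eq_mul]
    ring

/-- Write x + x' = (x' - x) + 2x. Each further direction of a flat contributes one more factor √2 to
the sum over it; dimensions 2 and 3 are used to detect affine maps and quadratic signs. -/
theorem exists_translate_add {m : ℕ} (a : Vec m) {x : Vec m → ZS} (hx : x ∈ lat m) :
    ∃ y ∈ lat m, ∀ v, x v + x (v + a) = Zsqrtd.sqrtd * y v := by
  obtain ⟨y, hy, h⟩ := exists_translate_sub a hx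
  refine ⟨y + (Zsqrtd.sqrtd : ZS) • x, add_mem hy (sqrtd_smul_mem hx), fun v => ?_⟩
  have h1 := congrFun h v
  simp only [Function.comp_apply, Pi.sub_apply, Pi.smul_apply, smul_eq_mul] at h1
  simp only [Pi.add_apply, Pi.smul_apply, smul_eq_mul, mul_add, ← mul_assoc, sqrtd_mul_self, ← h1]
  ring

theorem exists_sum_two_flat {m : ℕ} (a b : Vec m) {x : Vec m → ZS} (hx : x ∈ lat m) :
    ∃ y ∈ lat m, ∀ v, x v + x (v + a) + (x (v + b) + x (v + b + a)) = 2 * y v := by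
  obtain ⟨y, hy, h⟩ := exists_translate_add a hx
  obtain ⟨z, hz, h'⟩ := exists_translate_add b hy
  exact ⟨z, hz, fun v => by rw [h, h, ← mul_add, h', ← mul_assoc, sqrtd_mul_self]⟩

theorem exists_sum_three_flat {m : ℕ} (a b c v : Vec m) {x : Vec m → ZS} (hx : x ∈ lat m) :
    ∃ r : ZS, x v + x (v + a) + (x (v + b) + x (v + b + a)) +
      (x (v + c) + x (v + c + a) + (x (v + c + b) + x (v + c + b + a))) = 2 * Zsqrtd.sqrtd * r := by
  obtain ⟨y, hy, h⟩ := exists_sum_two_flat a b hx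
  obtain ⟨z, hz, h'⟩ := exists_translate_add c hy
  exact ⟨z v, by rw [h, h, ← mul_add, h', ← mul_assoc]⟩

/-! ### Signs of quadratic functions. -/

/-- The sign `(-1) ^ a`. -/
def signVal (a : ZMod 2) : ZS := if a = 0 then 1 else -1

/-- The sign function `(-1) ^ f`. -/
def signFun {m : ℕ} (f : Vec m → ZMod 2) : Vec m → ZS := fun v => signVal (f v)

/-- For a product of affine functions, (-1)^{fg} = 1 - (√2·1_{f=1})(√2·1_{g=1}); signs of sums are
products of signs. -/
theorem signFun_mem_lat {m : ℕ} {f : Vec m → ZMod 2} (hf : f ∈ affFun m * affFun m) :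
    signFun f ∈ lat m := by
  refine Submodule.mul_induction_on (C := fun f => signFun f ∈ lat m) hf ?_ ?_
  · intro f hf g hg
    have : signFun (f * g) = 1 - zeroInd (f + 1) * zeroInd (g + 1) := by
      funext v
      simp only [signFun, zeroInd, Pi.add_apply, Pi.sub_apply, Pi.mul_apply, Pi.one_apply]
      generalize f v = a
      generalize g v = b
      revert a b; decide
    rw [this]
    exact sub_mem (one_mem _) (mul_mem (zeroInd_mem_lat (add_mem hf one_mem_affFun))
      (zeroInd_mem_lat (add_mem hg one_mem_affFun)))
  · intro f g hf hg
    have : signFun (f + g) = signFun f * signFun g := by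
      funext v
      simp only [signFun, Pi.add_apply, Pi.mul_apply]
      generalize f v = a
      generalize g v = b
      revert a b; decide
    rw [this]
    exact mul_mem hf hg

theorem mem_affFun_of_add {m : ℕ} {f : Vec m → ZMod 2}
    (hf : ∀ a b, f (a + b) = f a + f b) : f ∈ affFun m := by
  have : f = ∑ t, f (Pi.single t 1) • (fun v : Vec m => v t) := by
    funext v
    let F : Vec m →+ ZMod 2 := AddMonoidHom.mk' f hf
    have h1 := LinearMap.pi_apply_eq_sum_univ (AddMonoidHom.toZModLinearMap 2 F) v
    have h2 : f v = ∑ i, v i • f (fun j => if i = j then 1 else 0) := h1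
    rw [h2]
    simp only [Finset.sum_apply, Pi.smul_apply, smul_eq_mul]
    refine Finset.sum_congr rfl fun i _ => ?_
    rw [mul_comm]
    congr 2
    funext j
    simp [Pi.single_apply, eq_comm]
  rw [this]
  exact sum_mem fun t _ => Submodule.smul_mem _ _ (coord_mem_affFun t)

theorem mem_affFun_of_add_add {m : ℕ} {f : Vec m → ZMod 2}
    (hf : ∀ a b c, f (a + b + c) = f a + f b + f c) : f ∈ affFun m := by
  have h : (f + f 0 • (1 : Vec m → ZMod 2)) ∈ affFun m := by
    refine mem_affFun_of_add fun a b => ?_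
    have h1 := hf a b 0
    rw [add_zero] at h1
    simp only [Pi.add_apply, Pi.smul_apply, Pi.one_apply, smul_eq_mul, mul_one, h1]
    generalize f a = x
    generalize f b = y
    generalize f 0 = z
    revert x y z; decide
  have h2 := sub_mem h (Submodule.smul_mem _ (f 0) (one_mem_affFun (m := m)))
  rwa [add_sub_cancel_right] at h2

/-- All third differences of `f` vanish. -/
def IsQuad {m : ℕ} (f : Vec m → ZMod 2) : Prop :=
  ∀ a b c v, f v + f (v + a) + (f (v + b) + f (v + b + a)) +
    (f (v + c) + f (v + c + a) + (f (v + c + b) + f (v + c + b + a))) = 0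

theorem affFun_le_mul {m : ℕ} : affFun m ≤ affFun m * affFun m := by
  intro f hf
  have := Submodule.mul_mem_mul hf (one_mem_affFun (m := m))
  rwa [mul_one] at this

/-- Coordinates are switched on one at a time: f(x + v_s e) = f(x) + v_s (f(x+e) + f(x)), and the
difference in direction e is affine because third differences vanish. -/
theorem IsQuad.mem {m : ℕ} {f : Vec m → ZMod 2} (hf : IsQuad f) :
    f ∈ affFun m * affFun m := by
  have key : ∀ s : Finset (Fin m),
      (fun v : Vec m => f (∑ t ∈ s, v t • Pi.single t 1)) ∈ affFun m * affFun m := by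
    intro s
    induction s using Finset.induction_on with
    | empty =>
      have : (fun v : Vec m => f (∑ t ∈ (∅ : Finset (Fin m)), v t • Pi.single t 1))
          = f 0 • (1 : Vec m → ZMod 2) := by
        funext v; simp
      rw [this]
      exact affFun_le_mul (Submodule.smul_mem _ _ one_mem_affFun)
    | insert s S hs ih =>
      set P : Vec m → Vec m := fun v => ∑ t ∈ S, v t • Pi.single t 1 with hP
      set e : Vec m := Pi.single s 1
      -- The difference in direction e, normalised to vanish at 0; its additivity is the third
      -- difference of f at 0.
      set B : Vec m → ZMod 2 := fun x => f (x + e) + f x + f e + f 0 with hB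
      have hBadd : ∀ a b, B (a + b) = B a + B b := by
        intro a b
        have h := hf b a e 0
        simp only [zero_add] at h
        rw [show e + a + b = a + b + e by abel, add_comm e a, add_comm e b] at h
        simp only [hB]
        generalize f (a + b + e) = x1 at *
        generalize f (a + b) = x2 at *
        generalize f (a + e) = x3 at *
        generalize f (b + e) = x4 at *
        generalize f a = x5 at *
        generalize f b = x6 at *
        generalize f e = x7 at *
        generalize f 0 = x8 at *
        revert h
        clear * -
        revert x1 x2 x3 x4 x5 x6 x7 x8
        decide
      have hBP : (fun v => B (P v)) ∈ affFun m := by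
        refine mem_affFun_of_add fun a b => ?_
        rw [← hBadd]
        congr 1
        simp only [hP, Pi.add_apply, add_smul, Finset.sum_add_distrib]
      have : (fun v : Vec m => f (∑ t ∈ insert s S, v t • Pi.single t 1))
          = (fun v => f (P v)) + (fun v => v s) * ((fun v => B (P v)) + (f e + f 0) • 1) := by
        funext v
        rw [Finset.sum_insert hs]
        simp only [Pi.add_apply, Pi.mul_apply, Pi.smul_apply, Pi.one_apply, smul_eq_mul, mul_one]
        rcases zmod_two_cases (v s) with h | h
        · rw [h, zero_smul, zero_add, zero_mul, add_zero]
        · rw [h, one_smul, one_mul, add_comm]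
          simp only [hB]
          change f (P v + e) = _
          generalize f (P v + e) = x1
          generalize f (P v) = x2
          generalize f e = x3
          generalize f 0 = x4
          revert x1 x2 x3 x4
          decide
      rw [this]
      exact add_mem ih (Submodule.mul_mem_mul (coord_mem_affFun s)
        (add_mem hBP (Submodule.smul_mem _ _ one_mem_affFun)))
  have h := key Finset.univ
  have h2 : (fun v : Vec m => f (∑ t, v t • Pi.single t 1)) = f := by
    funext v
    congr 1
    funext j
    simp [Finset.sum_apply, Pi.single_apply]
  rwa [h2] at h

/-! ### Recursion on m and minimal vectors. -/

theorem sum_vec_succ {m : ℕ} {β : Type*} [AddCommMonoid β] (f : Vec (m + 1) → β) :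
    ∑ v, f v = ∑ u : Vec m, f (Fin.cons 0 u) + ∑ u : Vec m, f (Fin.cons 1 u) := by
  rw [← (Fin.consEquiv (fun _ : Fin (m + 1) => ZMod 2)).sum_comp f, Fintype.sum_prod_type]
  exact Fin.sum_univ_two (fun s : ZMod 2 => ∑ u : Vec m, f (Fin.cons s u))

/-- Restriction of `x` to the vectors with first coordinate `s`. -/
def slice {m : ℕ} {β : Type*} (s : ZMod 2) (x : Vec (m + 1) → β) : Vec m → β :=
  fun u => x (Fin.cons s u)

theorem ext_slice {m : ℕ} {β : Type*} {x y : Vec (m + 1) → β} (h0 : slice 0 x = slice 0 y)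
    (h1 : slice 1 x = slice 1 y) : x = y := by
  funext v
  rw [← Fin.cons_self_tail v]
  rcases zmod_two_cases (v 0) with h | h
  · rw [h]; exact congrFun h0 (Fin.tail v)
  · rw [h]; exact congrFun h1 (Fin.tail v)

/-- The (u + √2p | u) construction: row 0 of the 2 × 2 generator contributes (√2p | 0) and row 1
contributes (u | u). All inductions on m rest on it. -/
theorem mem_lat_succ {m : ℕ} {x : Vec (m + 1) → ZS} :
    x ∈ lat (m + 1) ↔ slice 1 x ∈ lat m ∧
      ∃ p ∈ lat m, slice 0 x = slice 1 x + (Zsqrtd.sqrtd : ZS) • p := by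
  constructor
  · intro hx
    refine lat_induction (p := fun x => slice 1 x ∈ lat m ∧
      ∃ p ∈ lat m, slice 0 x = slice 1 x + (Zsqrtd.sqrtd : ZS) • p) ?_ ?_ ?_ ?_ hx
    · intro u
      have hs : ∀ s, slice s (rowZ u) = genZ (u 0) s • rowZ (Fin.tail u) := by
        intro s; funext v
        simp [slice, rowZ, Fin.prod_univ_succ, Fin.tail]
      rw [hs, hs]
      rcases zmod_two_cases (u 0) with h | h
      · refine ⟨(lat m).smul_mem (rowZ_mem_lat _) _, rowZ (Fin.tail u), rowZ_mem_lat _, ?_⟩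
        simp [h, genZ]
      · refine ⟨(lat m).smul_mem (rowZ_mem_lat _) _, 0, zero_mem _, ?_⟩
        simp [h, genZ]
    · exact ⟨zero_mem (lat m), 0, zero_mem _, by funext v; simp [slice]⟩
    · rintro x y _ _ ⟨h1, p, hp, h⟩ ⟨h1', p', hp', h'⟩
      refine ⟨add_mem h1 h1', p + p', add_mem hp hp', ?_⟩
      change slice 0 x + slice 0 y = slice 1 x + slice 1 y + _
      rw [h, h', smul_add]
      abel
    · rintro r x _ ⟨h1, p, hp, h⟩
      refine ⟨(lat m).smul_mem h1 r, r • p, (lat m).smul_mem hp r, ?_⟩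
      change r • slice 0 x = r • slice 1 x + _
      rw [h, smul_add, smul_comm]
  · rintro ⟨h1, p, hp, h⟩
    have htail : ∀ {y : Vec m → ZS}, y ∈ lat m → (fun v : Vec (m + 1) => y (Fin.tail v)) ∈ lat (m + 1) :=
      fun hy => comp_mem_lat (π := Fin.tail) (fun t => coord_mem_affFun t.succ) hy
    have : x = zeroInd (fun v => v 0) * (fun v => p (Fin.tail v)) +
        fun v => slice 1 x (Fin.tail v) := by
      refine ext_slice ?_ ?_
      · rw [h]; funext u
        simp [slice, zeroInd, zeroVal, add_comm]
      · funext u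
        simp [slice, zeroInd, zeroVal]
    rw [this]
    exact add_mem (mul_mem (zeroInd_coord_mem 0) (htail hp)) (htail h1)

/-- The rational part of the squared length of `x`. -/
def nrm {m : ℕ} (x : Vec m → ZS) : ℤ := ∑ v, ((x v).re ^ 2 + 2 * (x v).im ^ 2)

theorem nrm_slice {m : ℕ} (x : Vec (m + 1) → ZS) : nrm x = nrm (slice 0 x) + nrm (slice 1 x) :=
  sum_vec_succ _

theorem nrm_zero {m : ℕ} : nrm (0 : Vec m → ZS) = 0 := by simp [nrm]

theorem nrm_neg {m : ℕ} (x : Vec m → ZS) : nrm (-x) = nrm x := by simp [nrm]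

theorem nrm_sqrtd_smul {m : ℕ} (x : Vec m → ZS) :
    nrm ((Zsqrtd.sqrtd : ZS) • x) = 2 * nrm x := by
  simp only [nrm, Finset.mul_sum]
  refine Finset.sum_congr rfl fun v _ => ?_
  simp only [Pi.smul_apply, smul_eq_mul, Zsqrtd.re_mul, Zsqrtd.im_mul, Zsqrtd.re_sqrtd,
    Zsqrtd.im_sqrtd]
  ring

/-- If one half of x vanishes, the other is √2 times a lattice vector, which doubles its norm;
otherwise both halves are nonzero and each contributes at least 2^m. -/
theorem le_nrm {m : ℕ} {x : Vec m → ZS} (hx : x ∈ lat m) (h0 : x ≠ 0) : 2 ^ m ≤ nrm x := by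
  induction m with
  | zero =>
    have hx0 : x 0 ≠ 0 := by
      intro h
      apply h0
      funext v
      rw [Subsingleton.elim v 0, h]; rfl
    have : nrm x = (x 0).re ^ 2 + 2 * (x 0).im ^ 2 := by
      simp [nrm]; rfl
    rw [this, pow_zero]
    by_contra! hlt
    apply hx0
    have h1 : (x 0).re = 0 := by nlinarith [sq_nonneg (x 0).re, sq_nonneg (x 0).im]
    have h2 : (x 0).im = 0 := by nlinarith [sq_nonneg (x 0).re, sq_nonneg (x 0).im]
    ext
    · simpa using h1
    · simpa using h2
  | succ m ih =>
    obtain ⟨h1, p, hp, h⟩ := mem_lat_succ.1 hx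
    have hs0 : slice 0 x ∈ lat m := by rw [h]; exact add_mem h1 (sqrtd_smul_mem hp)
    rw [nrm_slice, pow_succ]
    by_cases hz1 : slice 1 x = 0
    · rw [hz1, zero_add] at h
      have hp0 : p ≠ 0 := by
        rintro rfl
        rw [smul_zero] at h
        exact h0 (ext_slice h hz1)
      rw [h, nrm_sqrtd_smul, hz1, nrm_zero]
      linarith [ih hp hp0]
    · by_cases hz0 : slice 0 x = 0
      · rw [hz0] at h
        have h' : slice 1 x = (Zsqrtd.sqrtd : ZS) • (-p) := by
          rw [smul_neg, eq_neg_iff_add_eq_zero, ← h]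
        have hp0 : -p ≠ 0 := by
          intro hp0
          rw [hp0, smul_zero] at h'
          exact hz1 h'
        rw [h', nrm_sqrtd_smul, hz0, nrm_zero]
        linarith [ih (neg_mem hp) hp0]
      · linarith [ih h1 hz1, ih hs0 hz0]

/-- The lattice vector `√2 ^ m e_w`. -/
def frameVec {m : ℕ} (w : Vec m) : Vec m → ZS := Pi.single w (Zsqrtd.sqrtd ^ m)

theorem frameVec_zero_mem {m : ℕ} : frameVec (0 : Vec m) ∈ lat m := by
  have : frameVec (0 : Vec m) = rowZ 0 := by
    funext v
    simp only [frameVec, rowZ, Pi.single_apply, Pi.zero_apply, genZ, if_true]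
    by_cases h : v = 0
    · simp [h]
    · rw [if_neg h]
      obtain ⟨t, ht⟩ := Function.ne_iff.1 h
      exact (Finset.prod_eq_zero (Finset.mem_univ t) (if_neg ht)).symm
  rw [this]
  exact rowZ_mem_lat _

theorem frameVec_translate {m : ℕ} (a : Vec m) : frameVec (0 : Vec m) ∘ (· + a) = frameVec a := by
  funext v
  have : v + a = 0 ↔ v = a := by
    rw [add_eq_zero_iff_eq_neg, ZModModule.neg_eq_self]
  simp [frameVec, Pi.single_apply, this]

theorem slice_frameVec {m : ℕ} (s r : ZMod 2) (w : Vec m) :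
    slice s (frameVec (Fin.cons r w : Vec (m + 1))) =
      if s = r then (Zsqrtd.sqrtd : ZS) • frameVec w else 0 := by
  funext u
  by_cases h : s = r
  · subst h
    by_cases hw : u = w
    · subst hw
      simp [slice, frameVec, pow_succ, mul_comm]
    · simp [slice, frameVec, Fin.cons_inj, hw]
  · simp [slice, frameVec, Fin.cons_inj, h]

theorem eq_frameVec_of_nrm_eq_one {b : Vec 0 → ZS} (hn : nrm b = 1) :
    b = frameVec 0 ∨ b = -frameVec 0 := by
  have : nrm b = (b 0).re ^ 2 + 2 * (b 0).im ^ 2 := by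
    simp [nrm]; rfl
  rw [this] at hn
  have h2 : (b 0).im = 0 := by nlinarith [sq_nonneg (b 0).re, sq_nonneg (b 0).im]
  rw [h2] at hn
  have h1 : (b 0).re = 1 ∨ (b 0).re = -1 := by
    have h3 : ((b 0).re - 1) * ((b 0).re + 1) = 0 := by linarith
    rcases mul_eq_zero.1 h3 with h3 | h3
    · exact Or.inl (by linarith)
    · exact Or.inr (by linarith)
  refine h1.imp (fun h => ?_) (fun h => ?_)
  · have h0 : b 0 = 1 := Zsqrtd.ext h h2
    funext v
    rw [Subsingleton.elim v 0, h0]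
    simp [frameVec]
  · have h0 : b 0 = -1 := Zsqrtd.ext h (by simpa using h2)
    funext v
    rw [Subsingleton.elim v 0, h0]
    simp [frameVec]

/-- Both halves of b are divisible by √2, so two nonzero halves would give norm at least 4·2^m,
twice what is allowed. The nonzero half divided by √2 is again minimal and, up to sign, congruent to
the frame vector at 0. -/
theorem exists_eq_frameVec {m : ℕ} {b : Vec m → ZS} (hb : b ∈ lat m) (hn : nrm b = 2 ^ m)
    (hc : ∃ y ∈ lat m, b - frameVec 0 = (Zsqrtd.sqrtd : ZS) • y) :
    ∃ w, b = frameVec w ∨ b = -frameVec w := by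
  induction m with
  | zero =>
    exact ⟨0, eq_frameVec_of_nrm_eq_one (by simpa using hn)⟩
  | succ m ih =>
    obtain ⟨y, hy, hc⟩ := hc
    obtain ⟨h1, p, hp, h⟩ := mem_lat_succ.1 hy
    have hs0 : slice 0 y ∈ lat m := by rw [h]; exact add_mem h1 (sqrtd_smul_mem hp)
    have hzero : (0 : Vec (m + 1)) = Fin.cons 0 0 := by
      funext i; refine Fin.cases ?_ (fun _ => ?_) i <;> rfl
    have hb0 : slice 0 b = (Zsqrtd.sqrtd : ZS) • (frameVec 0 + slice 0 y) := by
      have h3 := congrArg (slice 0) hc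
      change slice 0 b - slice 0 (frameVec 0) = (Zsqrtd.sqrtd : ZS) • slice 0 y at h3
      rw [hzero, slice_frameVec, if_pos rfl] at h3
      rw [smul_add, ← h3]; abel
    have hb1 : slice 1 b = (Zsqrtd.sqrtd : ZS) • slice 1 y := by
      have h3 := congrArg (slice 1) hc
      change slice 1 b - slice 1 (frameVec 0) = (Zsqrtd.sqrtd : ZS) • slice 1 y at h3
      rw [hzero, slice_frameVec, if_neg one_ne_zero, sub_zero] at h3
      exact h3
    have hmem : frameVec 0 + slice 0 y ∈ lat m := add_mem frameVec_zero_mem hs0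
    rw [nrm_slice, hb0, hb1, nrm_sqrtd_smul, nrm_sqrtd_smul, pow_succ] at hn
    by_cases hz1 : slice 1 y = 0
    · rw [hz1, nrm_zero] at hn
      obtain ⟨w, hw⟩ := ih hmem (by linarith) ⟨p, hp, by rw [h, hz1]; abel⟩
      refine ⟨Fin.cons 0 w, hw.imp (fun hw => ?_) (fun hw => ?_)⟩
      · refine ext_slice ?_ ?_
        · rw [hb0, hw, slice_frameVec, if_pos rfl]
        · rw [hb1, hz1, slice_frameVec, if_neg one_ne_zero, smul_zero]
      · refine ext_slice ?_ ?_
        · change _ = -slice 0 (frameVec _)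
          rw [hb0, hw, slice_frameVec, if_pos rfl, smul_neg]
        · change _ = -slice 1 (frameVec _)
          rw [hb1, hz1, slice_frameVec, if_neg one_ne_zero, smul_zero, neg_zero]
    · by_cases hz0 : frameVec 0 + slice 0 y = 0
      · rw [hz0, nrm_zero] at hn
        -- The two halves of y agree modulo √2, so the vanishing of the first half of b makes the
        -- negative of `slice 1 y` congruent to `frameVec 0`. The sign accounts for the later swap
        -- of the alternatives.
        obtain ⟨w, hw⟩ := ih (neg_mem h1) (by rw [nrm_neg]; linarith) ⟨p, hp, by
          rw [h] at hz0
          have h4 : frameVec 0 + (Zsqrtd.sqrtd : ZS) • p = - slice 1 y := by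
            rw [eq_neg_iff_add_eq_zero, ← hz0]; abel
          rw [← h4]; abel⟩
        refine ⟨Fin.cons 1 w, hw.symm.imp (fun hw => ?_) (fun hw => ?_)⟩
        · refine ext_slice ?_ ?_
          · rw [hb0, hz0, slice_frameVec, if_neg zero_ne_one, smul_zero]
          · rw [hb1, neg_inj.1 hw, slice_frameVec, if_pos rfl]
        · refine ext_slice ?_ ?_
          · change _ = -slice 0 (frameVec _)
            rw [hb0, hz0, slice_frameVec, if_neg zero_ne_one, smul_zero, neg_zero]
          · change _ = -slice 1 (frameVec _)
            rw [hb1, slice_frameVec, if_pos rfl, ← hw, smul_neg, neg_neg]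
      · have := le_nrm h1 hz1
        have := le_nrm hmem hz0
        have : (0 : ℤ) < 2 ^ m := by positivity
        linarith

/-! ### Passage to real vectors and Clifford matrices. -/

/-- The embedding of `ZS` into `ℝ`. -/
noncomputable def toR : ZS →+* ℝ := Zsqrtd.toReal (by norm_num)

theorem toR_injective : Function.Injective toR := by
  refine Zsqrtd.toReal_injective _ fun n h => ?_
  have h1 : n < 2 := by nlinarith
  have h2 : -2 < n := by nlinarith
  interval_cases n <;> omega

theorem toR_sqrtd : toR Zsqrtd.sqrtd = Real.sqrt 2 := by
  simp [toR, Zsqrtd.toReal]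

theorem toR_mem (r : ZS) : toR r ∈ ZSqrtTwo := by
  have h : r = (r.re : ZS) + Zsqrtd.sqrtd * (r.im : ZS) := Zsqrtd.decompose
  rw [h, map_add, map_mul, toR_sqrtd, map_intCast, map_intCast]
  exact add_mem (intCast_mem _ _) (mul_mem (Algebra.subset_adjoin rfl) (intCast_mem _ _))

theorem exists_toR_eq {r : ℝ} (hr : r ∈ ZSqrtTwo) : ∃ s, toR s = r := by
  refine Algebra.adjoin_induction (p := fun r _ => ∃ s, toR s = r) ?_ ?_ ?_ ?_ hr
  · rintro _ rfl
    exact ⟨_, toR_sqrtd⟩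
  · intro n
    exact ⟨n, by simp⟩
  · rintro _ _ _ _ ⟨a, rfl⟩ ⟨b, rfl⟩
    exact ⟨a + b, map_add _ _ _⟩
  · rintro _ _ _ _ ⟨a, rfl⟩ ⟨b, rfl⟩
    exact ⟨a * b, map_mul _ _ _⟩

theorem toR_genZ (i j : ZMod 2) : toR (genZ i j) = genOne i j := by
  simp only [genZ, genOne, Matrix.of_apply]
  split_ifs <;> simp [toR_sqrtd]

theorem toR_rowZ {m : ℕ} (u : Vec m) : (fun v => toR (rowZ u v)) = (gen m).row u := by
  funext v
  simp [rowZ, gen, Matrix.row, map_prod, toR_genZ]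

theorem mem_balancedBarnesWall_iff {m : ℕ} {v : Vec m → ℝ} :
    v ∈ balancedBarnesWall m ↔ ∃ x ∈ lat m, (fun w => toR (x w)) = v := by
  constructor
  · intro hv
    refine Submodule.span_induction (p := fun v _ => ∃ x ∈ lat m, (fun w => toR (x w)) = v)
      ?_ ⟨0, zero_mem _, by funext; simp⟩ ?_ ?_ hv
    · rintro _ ⟨u, rfl⟩
      exact ⟨_, rowZ_mem_lat u, toR_rowZ u⟩
    · rintro _ _ _ _ ⟨x, hx, rfl⟩ ⟨y, hy, rfl⟩
      exact ⟨x + y, add_mem hx hy, by funext; simp⟩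
    · rintro ⟨r, hr⟩ _ _ ⟨x, hx, rfl⟩
      obtain ⟨s, rfl⟩ := exists_toR_eq hr
      exact ⟨s • x, (lat m).smul_mem hx s, by funext w; simp [Algebra.smul_def]⟩
  · rintro ⟨x, hx, rfl⟩
    refine lat_induction (p := fun x => (fun w => toR (x w)) ∈ balancedBarnesWall m)
      ?_ ?_ ?_ ?_ hx
    · intro u
      rw [toR_rowZ]
      exact Submodule.subset_span ⟨u, rfl⟩
    · convert zero_mem (balancedBarnesWall m) using 1
      funext w
      simp
    · intro x y _ _ h h'
      convert add_mem h h' using 1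
      funext w
      simp
    · intro r x _ h
      have := (balancedBarnesWall m).smul_mem ⟨toR r, toR_mem r⟩ h
      convert this using 1
      funext w
      simp [Algebra.smul_def]

/-- Squared lengths lie in ℤ[√2], which embeds in ℝ, so equal real lengths have equal rational
parts. Hence orthogonal maps of the lattice preserve the integer `nrm`. -/
theorem nrm_eq_of_dotProduct_eq {m : ℕ} {x y : Vec m → ZS}
    (h : (fun v => toR (x v)) ⬝ᵥ (fun v => toR (x v)) = (fun v => toR (y v)) ⬝ᵥ fun v => toR (y v)) :
    nrm x = nrm y := by
  have key : ∀ x : Vec m → ZS, nrm x = (∑ v, x v * x v).re := by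
    intro x
    have : ∀ s : Finset (Vec m), (∑ v ∈ s, x v * x v).re = ∑ v ∈ s, (x v * x v).re := by
      intro s
      induction s using Finset.induction_on with
      | empty => simp
      | insert a s ha ih => rw [Finset.sum_insert ha, Finset.sum_insert ha, Zsqrtd.re_add, ih]
    rw [this, nrm]
    refine Finset.sum_congr rfl fun v _ => ?_
    rw [Zsqrtd.re_mul]
    ring
  rw [key, key]
  congr 1
  apply toR_injective
  simpa [dotProduct, map_sum] using h

/-- The real vector attached to `x`. -/
noncomputable def real {m : ℕ} (x : Vec m → ZS) : Vec m → ℝ := fun v => toR (x v)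

theorem real_injective {m : ℕ} : Function.Injective (real (m := m)) := fun _ _ h =>
  funext fun v => toR_injective (congrFun h v)

theorem real_add {m : ℕ} (x y : Vec m → ZS) : real (x + y) = real x + real y := by
  funext v; simp [real]

theorem real_sub {m : ℕ} (x y : Vec m → ZS) : real (x - y) = real x - real y := by
  funext v; simp [real]

theorem real_sqrtd_smul {m : ℕ} (x : Vec m → ZS) :
    real ((Zsqrtd.sqrtd : ZS) • x) = Real.sqrt 2 • real x := by
  funext v; simp [real, toR_sqrtd]

theorem mem_wall_iff {m : ℕ} {v : Vec m → ℝ} :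
    v ∈ balancedBarnesWall m ↔ ∃ x ∈ lat m, real x = v := mem_balancedBarnesWall_iff

theorem real_mem_wall_iff {m : ℕ} {x : Vec m → ZS} :
    real x ∈ balancedBarnesWall m ↔ x ∈ lat m := by
  rw [mem_wall_iff]
  exact ⟨fun ⟨y, hy, h⟩ => real_injective h ▸ hy, fun h => ⟨x, h, rfl⟩⟩

/-- `A` is orthogonal and preserves the balanced Barnes-Wall lattice. -/
def IsClifford {m : ℕ} (A : Matrix (Vec m) (Vec m) ℝ) : Prop :=
  A ∈ Matrix.orthogonalGroup (Vec m) ℝ ∧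
    ∀ v, A *ᵥ v ∈ balancedBarnesWall m ↔ v ∈ balancedBarnesWall m

theorem IsClifford.mul {m : ℕ} {A B : Matrix (Vec m) (Vec m) ℝ} (hA : IsClifford A)
    (hB : IsClifford B) : IsClifford (A * B) :=
  ⟨mul_mem hA.1 hB.1, fun v => by rw [← mulVec_mulVec, hA.2, hB.2]⟩

theorem IsClifford.exists_real {m : ℕ} {A : Matrix (Vec m) (Vec m) ℝ} (hA : IsClifford A)
    {x : Vec m → ZS} (hx : x ∈ lat m) : ∃ y ∈ lat m, A *ᵥ real x = real y ∧ nrm y = nrm x := by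
  obtain ⟨y, hy, h⟩ := mem_wall_iff.1 ((hA.2 (real x)).2 (real_mem_wall_iff.2 hx))
  refine ⟨y, hy, h.symm, nrm_eq_of_dotProduct_eq ?_⟩
  change real y ⬝ᵥ real y = real x ⬝ᵥ real x
  rw [h, dotProduct_mulVec, vecMul_mulVec, (Matrix.mem_orthogonalGroup_iff' _ _).1 hA.1,
    vecMul_one]

/-! ### The generating matrices. -/

/-- The sign `(-1) ^ a` as a real number. -/
noncomputable def signR (a : ZMod 2) : ℝ := if a = 0 then 1 else -1

theorem toR_signVal (a : ZMod 2) : toR (signVal a) = signR a := by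
  unfold signVal signR; split_ifs <;> simp

theorem signR_add (a b : ZMod 2) : signR (a + b) = signR a * signR b := by
  rcases zmod_two_cases a with rfl | rfl <;> rcases zmod_two_cases b with rfl | rfl <;>
    simp [signR, show (1 + 1 : ZMod 2) = 0 by decide]

theorem signR_mul_self (a : ZMod 2) : signR a * signR a = 1 := by
  unfold signR; split_ifs <;> simp

theorem signR_ne_zero (a : ZMod 2) : signR a ≠ 0 := by
  unfold signR; split_ifs <;> simp

/-- The map `π` of `𝔽₂^m` is affine. -/
def IsAffine {m : ℕ} (π : Vec m → Vec m) : Prop := ∀ a b c, π (a + b + c) = π a + π b + π c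

theorem IsAffine.coord_mem {m : ℕ} {π : Vec m → Vec m} (h : IsAffine π) (t : Fin m) :
    (fun v => π v t) ∈ affFun m :=
  mem_affFun_of_add_add fun a b c => congrFun (h a b c) t

theorem IsAffine.symm {m : ℕ} {π : Vec m ≃ Vec m} (h : IsAffine π) : IsAffine π.symm := by
  intro a b c
  rw [Equiv.symm_apply_eq, h]
  simp

/-- The matrix sending `e_v` to `(-1) ^ (f v) e_{π v}`. -/
noncomputable def signedPerm {m : ℕ} (π : Vec m ≃ Vec m) (f : Vec m → ZMod 2) :
    Matrix (Vec m) (Vec m) ℝ := Matrix.of fun u v => if u = π v then signR (f v) else 0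

theorem signedPerm_mulVec {m : ℕ} (π : Vec m ≃ Vec m) (f : Vec m → ZMod 2) (x : Vec m → ℝ)
    (u : Vec m) : (signedPerm π f *ᵥ x) (π u) = signR (f u) * x u := by
  simp only [mulVec, dotProduct, signedPerm, Matrix.of_apply]
  rw [Finset.sum_eq_single u]
  · simp
  · intro v _ hv
    rw [if_neg (fun h => hv (π.injective h).symm), zero_mul]
  · simp

/-- Affine substitutions preserve the ring, and multiplication by a quadratic sign is multiplication
by a ring element that is its own inverse. -/
theorem signedPerm_isClifford {m : ℕ} {π : Vec m ≃ Vec m} {f : Vec m → ZMod 2}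
    (hπ : IsAffine π) (hf : IsQuad f) : IsClifford (signedPerm π f) := by
  refine ⟨(Matrix.mem_orthogonalGroup_iff' _ _).2 ?_, fun v => ⟨fun h => ?_, fun h => ?_⟩⟩
  · ext v w
    simp only [Matrix.mul_apply, Matrix.transpose_apply, signedPerm, Matrix.of_apply]
    rw [Finset.sum_eq_single (π v)]
    · by_cases h : v = w
      · subst h; simp [signR_mul_self]
      · simp [h]
    · intro u _ hu; simp [hu]
    · simp
  · obtain ⟨z, hz, hzv⟩ := mem_wall_iff.1 h
    refine mem_wall_iff.2 ⟨signFun f * (z ∘ π),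
      mul_mem (signFun_mem_lat hf.mem) (comp_mem_lat hπ.coord_mem hz), ?_⟩
    funext w
    have h1 := congrFun hzv (π w)
    rw [signedPerm_mulVec] at h1
    change toR (signVal (f w) * z (π w)) = v w
    rw [map_mul, toR_signVal]
    change _ * real z (π w) = _
    rw [h1, ← mul_assoc, signR_mul_self, one_mul]
  · obtain ⟨x, hx, rfl⟩ := mem_wall_iff.1 h
    refine mem_wall_iff.2 ⟨(signFun f * x) ∘ π.symm,
      comp_mem_lat hπ.symm.coord_mem (mul_mem (signFun_mem_lat hf.mem) hx), ?_⟩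
    funext w
    obtain ⟨w, rfl⟩ := π.surjective w
    rw [signedPerm_mulVec]
    simp [real, signFun, toR_signVal]

/-- The Kronecker product of a family of `2 × 2` matrices. -/
noncomputable def kron {m : ℕ} (B : Fin m → Matrix (ZMod 2) (ZMod 2) ℝ) :
    Matrix (Vec m) (Vec m) ℝ := Matrix.of fun u v => ∏ s, B s (u s) (v s)

theorem kron_mulVec_prod {m : ℕ} (B : Fin m → Matrix (ZMod 2) (ZMod 2) ℝ)
    (g : Fin m → ZMod 2 → ℝ) :
    kron B *ᵥ (fun v => ∏ s, g s (v s)) = fun u => ∏ s, (B s *ᵥ g s) (u s) := by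
  funext u
  simp only [mulVec, dotProduct, kron, Matrix.of_apply, ← Finset.prod_mul_distrib]
  rw [Finset.prod_univ_sum, Fintype.piFinset_univ]

theorem kron_mul {m : ℕ} (B B' : Fin m → Matrix (ZMod 2) (ZMod 2) ℝ) :
    kron B * kron B' = kron fun s => B s * B' s := by
  ext u v
  simp only [Matrix.mul_apply, kron, Matrix.of_apply, ← Finset.prod_mul_distrib]
  rw [Finset.prod_univ_sum, Fintype.piFinset_univ]

theorem kron_one {m : ℕ} : kron (fun _ : Fin m => 1) = 1 := by
  ext u v
  simp only [kron, Matrix.of_apply, Matrix.one_apply]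
  by_cases h : u = v
  · simp [h]
  · rw [if_neg h]
    obtain ⟨t, ht⟩ := Function.ne_iff.1 h
    exact Finset.prod_eq_zero (Finset.mem_univ t) (if_neg ht)

/-- The `2 × 2` Hadamard matrix. -/
noncomputable def hadOne : Matrix (ZMod 2) (ZMod 2) ℝ :=
  Matrix.of fun i j => (Real.sqrt 2)⁻¹ * signR (i * j)

/-- The Hadamard matrix acting on the tensor factor `t`. -/
noncomputable def hadAt {m : ℕ} (t : Fin m) : Matrix (Vec m) (Vec m) ℝ :=
  kron fun s => if s = t then hadOne else 1

theorem sum_zmod_two {β : Type*} [AddCommMonoid β] (f : ZMod 2 → β) : ∑ s, f s = f 0 + f 1 :=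
  Fin.sum_univ_two f

theorem signR_zero : signR 0 = 1 := by simp [signR]

theorem signR_one : signR 1 = -1 := by simp [signR]

theorem sqrt_two_inv_mul_self : (Real.sqrt 2)⁻¹ * (Real.sqrt 2)⁻¹ = 2⁻¹ := by
  rw [← mul_inv, Real.mul_self_sqrt (by norm_num)]

theorem hadOne_mul_self : hadOne * hadOne = 1 := by
  ext i j
  simp only [Matrix.mul_apply, sum_zmod_two, hadOne, Matrix.of_apply]
  have := sqrt_two_inv_mul_self
  rcases zmod_two_cases i with rfl | rfl <;> rcases zmod_two_cases j with rfl | rfl <;>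
    simp [signR_zero, signR_one, this] <;> norm_num

/-- The Hadamard matrix interchanges (√2, 0) and (1, 1), so `hadAt` permutes the generators of the
lattice. -/
theorem hadOne_mulVec_row (i : ZMod 2) : hadOne *ᵥ genOne.row i = genOne.row (i + 1) := by
  have h3 : (Real.sqrt 2)⁻¹ + (Real.sqrt 2)⁻¹ = Real.sqrt 2 := by
    have : Real.sqrt 2 * Real.sqrt 2 = 2 := Real.mul_self_sqrt (by norm_num)
    have h0 : Real.sqrt 2 ≠ 0 := by positivity
    field_simp
    linarith
  have h4 : (1 + 1 : ZMod 2) = 0 := by decide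
  funext j
  simp only [mulVec, dotProduct, sum_zmod_two, hadOne, Matrix.of_apply, Matrix.row, genOne]
  rcases zmod_two_cases i with rfl | rfl <;> rcases zmod_two_cases j with rfl | rfl <;>
    simp [signR_zero, signR_one, h3, h4]

theorem hadAt_mul_self {m : ℕ} (t : Fin m) : hadAt t * hadAt t = 1 := by
  rw [hadAt, kron_mul, ← kron_one]
  congr 1
  funext s
  split_ifs <;> simp [hadOne_mul_self]

theorem hadAt_transpose {m : ℕ} (t : Fin m) : (hadAt t)ᵀ = hadAt t := by
  ext u v
  simp only [hadAt, kron, Matrix.transpose_apply, Matrix.of_apply]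
  refine Finset.prod_congr rfl fun s _ => ?_
  split_ifs
  · simp [hadOne, mul_comm]
  · simp [Matrix.one_apply, eq_comm]

theorem hadAt_mulVec_mem {m : ℕ} (t : Fin m) {v : Vec m → ℝ} (hv : v ∈ balancedBarnesWall m) :
    hadAt t *ᵥ v ∈ balancedBarnesWall m := by
  refine Submodule.span_induction (p := fun v _ => hadAt t *ᵥ v ∈ balancedBarnesWall m)
    ?_ ?_ ?_ ?_ hv
  · rintro _ ⟨u, rfl⟩
    have : hadAt t *ᵥ (gen m).row u = (gen m).row (Function.update u t (u t + 1)) := by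
      change hadAt t *ᵥ (fun v => ∏ s, genOne.row (u s) (v s)) = _
      rw [hadAt, kron_mulVec_prod]
      funext v
      simp only [gen, Matrix.row, Matrix.of_apply]
      refine Finset.prod_congr rfl fun s _ => ?_
      by_cases h : s = t
      · subst h
        have := congrFun (hadOne_mulVec_row (u s)) (v s)
        simpa [Matrix.row] using this
      · simp [h]
    rw [this]
    exact Submodule.subset_span ⟨_, rfl⟩
  · rw [mulVec_zero]; exact zero_mem _
  · intro x y _ _ hx hy
    rw [mulVec_add]; exact add_mem hx hy
  · intro r x _ hx
    rw [mulVec_smul]; exact Submodule.smul_mem _ _ hx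

theorem hadAt_isClifford {m : ℕ} (t : Fin m) : IsClifford (hadAt t) := by
  refine ⟨(Matrix.mem_orthogonalGroup_iff _ _).2 ?_, fun v => ⟨fun h => ?_, hadAt_mulVec_mem t⟩⟩
  · rw [hadAt_transpose, hadAt_mul_self]
  · have := hadAt_mulVec_mem t h
    rwa [mulVec_mulVec, hadAt_mul_self, one_mulVec] at this

/-- The matrices generated by affine permutations, quadratic sign changes and Hadamard matrices. -/
inductive Gen {m : ℕ} : Matrix (Vec m) (Vec m) ℝ → Prop
  | signedPerm (π : Vec m ≃ Vec m) (f : Vec m → ZMod 2) (hπ : IsAffine π) (hf : IsQuad f) :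
      Gen (signedPerm π f)
  | hadAt (t : Fin m) : Gen (hadAt t)
  | mul {A B : Matrix (Vec m) (Vec m) ℝ} (hA : Gen A) (hB : Gen B) : Gen (A * B)

theorem Gen.isClifford {m : ℕ} {A : Matrix (Vec m) (Vec m) ℝ} (h : Gen A) : IsClifford A := by
  induction h with
  | signedPerm π f hπ hf => exact signedPerm_isClifford hπ hf
  | hadAt t => exact hadAt_isClifford t
  | mul _ _ h1 h2 => exact h1.mul h2

/-- The Kronecker product of the `2 × 2` identity matrix with `A`. -/
noncomputable def liftMat {m : ℕ} (A : Matrix (Vec m) (Vec m) ℝ) :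
    Matrix (Vec (m + 1)) (Vec (m + 1)) ℝ :=
  Matrix.of fun u v => if u 0 = v 0 then A (Fin.tail u) (Fin.tail v) else 0

theorem slice_liftMat_mulVec {m : ℕ} (A : Matrix (Vec m) (Vec m) ℝ) (s : ZMod 2)
    (x : Vec (m + 1) → ℝ) : slice s (liftMat A *ᵥ x) = A *ᵥ slice s x := by
  funext u
  simp only [slice, mulVec, dotProduct, liftMat, Matrix.of_apply]
  rw [sum_vec_succ]
  rcases zmod_two_cases s with rfl | rfl <;> simp

theorem liftMat_mul {m : ℕ} (A B : Matrix (Vec m) (Vec m) ℝ) :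
    liftMat (A * B) = liftMat A * liftMat B := by
  ext u v
  simp only [liftMat, Matrix.of_apply, Matrix.mul_apply]
  rw [sum_vec_succ]
  rcases zmod_two_cases (u 0) with h | h <;> rcases zmod_two_cases (v 0) with h' | h' <;>
    simp [h, h']

/-- Lets a matrix found by induction act on both halves of a vector simultaneously. -/
theorem liftMat_gen {m : ℕ} {A : Matrix (Vec m) (Vec m) ℝ} (h : Gen A) : Gen (liftMat A) := by
  induction h with
  | signedPerm π f hπ hf =>
    let π' : Vec (m + 1) ≃ Vec (m + 1) :=
      { toFun := fun v => Fin.cons (v 0) (π (Fin.tail v))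
        invFun := fun v => Fin.cons (v 0) (π.symm (Fin.tail v))
        left_inv := fun v => by simp
        right_inv := fun v => by simp }
    have h1 : liftMat (CliffordInvariants.signedPerm π f)
        = CliffordInvariants.signedPerm π' (fun v => f (Fin.tail v)) := by
      ext u v
      have : u = π' v ↔ u 0 = v 0 ∧ Fin.tail u = π (Fin.tail v) := by
        constructor
        · rintro rfl; exact ⟨rfl, rfl⟩
        · rintro ⟨h1, h2⟩
          change u = Fin.cons (v 0) (π (Fin.tail v))
          rw [← h1, ← h2, Fin.cons_self_tail]
      simp only [liftMat, CliffordInvariants.signedPerm, Matrix.of_apply, this]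
      by_cases h : u 0 = v 0 <;> simp [h]
    rw [h1]
    refine Gen.signedPerm _ _ (fun a b c => ?_) (fun a b c v => ?_)
    · have h2 := hπ (Fin.tail a) (Fin.tail b) (Fin.tail c)
      funext i
      refine Fin.cases rfl (fun j => ?_) i
      exact congrFun h2 j
    · exact hf (Fin.tail a) (Fin.tail b) (Fin.tail c) (Fin.tail v)
  | hadAt t =>
    have h1 : liftMat (CliffordInvariants.hadAt t) = CliffordInvariants.hadAt t.succ := by
      ext u v
      simp only [liftMat, CliffordInvariants.hadAt, kron, Matrix.of_apply, Fin.prod_univ_succ,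
        Fin.succ_inj, (Fin.succ_ne_zero t).symm, if_false, Matrix.one_apply, Fin.tail]
      by_cases h : u 0 = v 0 <;> simp [h]
    rw [h1]
    exact Gen.hadAt _
  | mul _ _ h1 h2 => rw [liftMat_mul]; exact h1.mul h2

/-! ### Transitivity on minimal vectors. -/

theorem nrm_frameVec {m : ℕ} (w : Vec m) : nrm (frameVec w) = 2 ^ m := by
  induction m with
  | zero =>
    have : nrm (frameVec w) = (frameVec w w).re ^ 2 + 2 * (frameVec w w).im ^ 2 := by
      rw [nrm, Fintype.sum_unique, Subsingleton.elim (@default (Vec 0) Unique.instInhabited) w]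
    rw [this]
    simp [frameVec]
  | succ m ih =>
    rw [← Fin.cons_self_tail w, nrm_slice, slice_frameVec, slice_frameVec]
    rcases zmod_two_cases (w 0) with h | h <;>
      simp [h, nrm_sqrtd_smul, nrm_zero, ih, pow_succ, mul_comm]

theorem isQuad_const {m : ℕ} (c : ZMod 2) : IsQuad (fun _ : Vec m => c) := by
  intro _ _ _ _
  change c + c + (c + c) + (c + c + (c + c)) = 0
  revert c; decide

theorem isQuad_coord {m : ℕ} (c d : ZMod 2) (t : Fin m) :
    IsQuad (fun v : Vec m => c * (v t + d)) := by
  intro x y z v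
  simp only [Pi.add_apply]
  generalize x t = x
  generalize y t = y
  generalize z t = z
  generalize v t = v
  revert c d x y z v; decide

theorem vec_add_self {m : ℕ} (v : Vec m) : v + v = 0 :=
  funext fun t => CharTwo.add_self_eq_zero (v t)

/-- The translation by `a`. -/
def translation {m : ℕ} (a : Vec m) : Vec m ≃ Vec m where
  toFun v := v + a
  invFun v := v + a
  left_inv v := by simp [add_assoc, vec_add_self]
  right_inv v := by simp [add_assoc, vec_add_self]

theorem isAffine_translation {m : ℕ} (a : Vec m) : IsAffine (translation a) := by
  intro x y z
  simp only [translation, Equiv.coe_fn_mk]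
  have : x + a + (y + a) + (z + a) = x + y + z + a + (a + a) := by abel
  rw [this, vec_add_self, add_zero]

/-- Some generated matrix maps `x` to the first frame vector. -/
def Reach {m : ℕ} (x : Vec m → ZS) : Prop :=
  ∃ A, Gen A ∧ A *ᵥ real x = real (frameVec (0 : Vec m))

theorem Reach.of_gen {m : ℕ} {A : Matrix (Vec m) (Vec m) ℝ} (hA : Gen A) {x y : Vec m → ZS}
    (h : A *ᵥ real x = real y) (hy : Reach y) : Reach x := by
  obtain ⟨B, hB, hBy⟩ := hy
  exact ⟨B * A, hB.mul hA, by rw [← mulVec_mulVec, h, hBy]⟩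

theorem reach_frameVec {m : ℕ} (a : Vec m) : Reach (frameVec a) := by
  refine ⟨_, Gen.signedPerm (translation a) _ (isAffine_translation a) (isQuad_const 0), ?_⟩
  funext w
  obtain ⟨w, rfl⟩ := (translation a).surjective w
  rw [signedPerm_mulVec, signR_zero, one_mul]
  have := congrFun (frameVec_translate a) w
  simp only [Function.comp_apply] at this
  simp [real, translation, this]

theorem slice_real {m : ℕ} (s : ZMod 2) (x : Vec (m + 1) → ZS) :
    slice s (real x) = real (slice s x) := rfl

theorem zero_eq_cons {m : ℕ} : (0 : Vec (m + 1)) = Fin.cons 0 0 := by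
  funext i
  refine Fin.cases ?_ (fun _ => ?_) i <;> rfl

/-- The Hadamard matrix in the first factor turns (f | f) into (√2f | 0), which is the frame vector
at 0 one level up. -/
theorem reach_of_slice_eq_frameVec {m : ℕ} {x : Vec (m + 1) → ZS}
    (h0 : slice 0 x = frameVec 0) (h1 : slice 1 x = frameVec 0) : Reach x := by
  refine ⟨_, Gen.hadAt 0, ?_⟩
  have key : ∀ s, slice s (hadAt 0 *ᵥ real x) = (hadOne s 0 + hadOne s 1) • real (frameVec 0) := by
    intro s
    funext u
    have hM : ∀ r v, hadAt 0 (Fin.cons s u) (Fin.cons r v : Vec (m + 1))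
        = hadOne s r * (1 : Matrix (Vec m) (Vec m) ℝ) u v := by
      intro r v
      rw [← kron_one]
      simp only [hadAt, kron, Fin.prod_univ_succ, Matrix.of_apply, Fin.cons_zero,
        if_true, Fin.succ_ne_zero, if_false]
      rfl
    simp only [slice, mulVec, dotProduct]
    rw [sum_vec_succ]
    have e0 : ∀ v, real x (Fin.cons 0 v) = real (frameVec 0) v := fun v =>
      congrArg toR (congrFun h0 v)
    have e1 : ∀ v, real x (Fin.cons 1 v) = real (frameVec 0) v := fun v =>
      congrArg toR (congrFun h1 v)
    simp only [hM, e0, e1, Matrix.one_apply]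
    simp [add_mul]
  have hs : (Real.sqrt 2)⁻¹ + (Real.sqrt 2)⁻¹ = Real.sqrt 2 := by
    have : Real.sqrt 2 * Real.sqrt 2 = 2 := Real.mul_self_sqrt (by norm_num)
    have h0 : Real.sqrt 2 ≠ 0 := by positivity
    field_simp
    linarith
  refine ext_slice ?_ ?_
  · rw [key, slice_real, zero_eq_cons, slice_frameVec, if_pos rfl, real_sqrtd_smul]
    simp [hadOne, signR_zero, hs]
  · rw [key, slice_real, zero_eq_cons, slice_frameVec, if_neg one_ne_zero]
    funext u
    simp [hadOne, signR_zero, signR_one, real]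

/-- The shear `(s, u) ↦ (s, u + (s + 1) w)`. -/
def shear {m : ℕ} (w : Vec m) : Vec (m + 1) ≃ Vec (m + 1) where
  toFun v := v + (v 0 + 1) • Fin.cons 0 w
  invFun v := v + (v 0 + 1) • Fin.cons 0 w
  left_inv v := by simp [add_assoc, vec_add_self]
  right_inv v := by simp [add_assoc, vec_add_self]

theorem isAffine_shear {m : ℕ} (w : Vec m) : IsAffine (shear w) := by
  intro x y z
  funext i
  simp only [shear, Equiv.coe_fn_mk, Pi.add_apply, Pi.smul_apply, smul_eq_mul]
  generalize (Fin.cons 0 w : Vec (m + 1)) i = c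
  generalize x i = x1
  generalize y i = y1
  generalize z i = z1
  generalize x 0 = x0
  generalize y 0 = y0
  generalize z 0 = z0
  revert c x1 y1 z1 x0 y0 z0; decide

theorem reach_of_slice {m : ℕ} {x : Vec (m + 1) → ZS} (w : Vec m)
    (h0 : slice 0 x = frameVec w ∨ slice 0 x = -frameVec w) (h1 : slice 1 x = frameVec 0) :
    Reach x := by
  obtain ⟨ε, hε⟩ : ∃ ε : ZMod 2, ∀ u, signVal ε * slice 0 x u = frameVec w u := by
    rcases h0 with h0 | h0
    · exact ⟨0, fun u => by simp [h0, signVal]⟩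
    · exact ⟨1, fun u => by simp [h0, signVal]⟩
  -- Both the shift (v 0 + 1)w and the sign exponent ε(v 0 + 1) are trivial on the half v 0 = 1; on
  -- the other half they bring ±`frameVec w` to `frameVec 0`.
  have hg := Gen.signedPerm (shear w) _ (isAffine_shear w) (isQuad_coord ε 1 0)
  refine Reach.of_gen hg (y := fun v => frameVec 0 (Fin.tail v)) ?_
    (reach_of_slice_eq_frameVec (by funext u; simp [slice]) (by funext u; simp [slice]))
  funext v
  obtain ⟨v, rfl⟩ := (shear w).surjective v
  rw [signedPerm_mulVec, ← toR_signVal]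
  change _ * toR _ = toR _
  rw [← map_mul]
  congr 1
  have ht : Fin.tail (shear w v) = Fin.tail v + (v 0 + 1) • w := by
    funext i
    simp [shear, Fin.tail]
  change _ = frameVec 0 (Fin.tail (shear w v))
  rw [ht]
  rcases zmod_two_cases (v 0) with h | h
  · have h2 := hε (Fin.tail v)
    have h3 : slice 0 x (Fin.tail v) = x v := by
      rw [slice, ← h, Fin.cons_self_tail]
    rw [h3, ← frameVec_translate] at h2
    simpa [h] using h2
  · have h3 : slice 1 x (Fin.tail v) = x v := by
      rw [slice, ← h, Fin.cons_self_tail]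
    rw [h, ← h3, h1]
    simp [show (1 + 1 : ZMod 2) = 0 by decide, signVal]

/-- If a half vanishes, the other is √2 times a minimal vector and induction applies. Otherwise both
halves are minimal and congruent modulo √2. Moving half 1 to `frameVec 0` makes the image of half 0
congruent to `frameVec 0`, hence plus or minus a frame vector, and a shear followed by a Hadamard
matrix finishes. -/
theorem reach_of_nrm {m : ℕ} {x : Vec m → ZS} (hx : x ∈ lat m) (hn : nrm x = 2 ^ m) : Reach x := by
  induction m with
  | zero =>
    rcases eq_frameVec_of_nrm_eq_one (by simpa using hn) with rfl | rfl
    · exact reach_frameVec 0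
    · refine Reach.of_gen (Gen.signedPerm (translation 0) _ (isAffine_translation 0)
        (isQuad_const 1)) (y := frameVec 0) ?_ (reach_frameVec 0)
      funext w
      obtain ⟨w, rfl⟩ := (translation 0).surjective w
      rw [signedPerm_mulVec, signR_one, Subsingleton.elim (translation 0 w) w]
      simp [real]
  | succ m ih =>
    obtain ⟨h1, p, hp, h⟩ := mem_lat_succ.1 hx
    have hs0 : slice 0 x ∈ lat m := by rw [h]; exact add_mem h1 (sqrtd_smul_mem hp)
    rw [nrm_slice, pow_succ] at hn
    have hzero : real (0 : Vec m → ZS) = 0 := by funext v; simp [real]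
    by_cases hz1 : slice 1 x = 0
    · rw [hz1, zero_add] at h
      rw [hz1, h, nrm_zero, nrm_sqrtd_smul] at hn
      obtain ⟨A, hA, hAp⟩ := ih hp (by linarith)
      refine Reach.of_gen (liftMat_gen hA) (y := frameVec (Fin.cons 0 0)) ?_ (reach_frameVec _)
      refine ext_slice ?_ ?_
      · rw [slice_liftMat_mulVec, slice_real, slice_real, h, slice_frameVec, if_pos rfl,
          real_sqrtd_smul, mulVec_smul, hAp, real_sqrtd_smul]
      · rw [slice_liftMat_mulVec, slice_real, slice_real, hz1, slice_frameVec,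
          if_neg one_ne_zero, hzero, mulVec_zero]
    · by_cases hz0 : slice 0 x = 0
      · rw [hz0] at h
        have h' : slice 1 x = (Zsqrtd.sqrtd : ZS) • (-p) := by
          rw [smul_neg, eq_neg_iff_add_eq_zero, ← h]
        rw [hz0, h', nrm_zero, nrm_sqrtd_smul] at hn
        obtain ⟨A, hA, hAp⟩ := ih (neg_mem hp) (by linarith)
        refine Reach.of_gen (liftMat_gen hA) (y := frameVec (Fin.cons 1 0)) ?_ (reach_frameVec _)
        refine ext_slice ?_ ?_
        · rw [slice_liftMat_mulVec, slice_real, slice_real, hz0, slice_frameVec,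
            if_neg zero_ne_one, hzero, mulVec_zero]
        · rw [slice_liftMat_mulVec, slice_real, slice_real, h', slice_frameVec, if_pos rfl,
            real_sqrtd_smul, mulVec_smul, hAp, real_sqrtd_smul]
      · have l0 := le_nrm hs0 hz0
        have l1 := le_nrm h1 hz1
        obtain ⟨A, hA, hA1⟩ := ih h1 (by linarith)
        obtain ⟨q, hq, hAq, -⟩ := hA.isClifford.exists_real hp
        obtain ⟨y, hy, hAy, hny⟩ := hA.isClifford.exists_real hs0
        have hyq : y = frameVec 0 + (Zsqrtd.sqrtd : ZS) • q := by
          apply real_injective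
          rw [← hAy, h, real_add, mulVec_add, hA1, real_sqrtd_smul, mulVec_smul, hAq,
            real_add, real_sqrtd_smul]
        obtain ⟨w, hw⟩ := exists_eq_frameVec hy (by linarith) ⟨q, hq, by rw [hyq]; abel⟩
        refine Reach.of_gen (liftMat_gen hA)
          (y := fun v => if v 0 = 0 then y (Fin.tail v) else frameVec 0 (Fin.tail v)) ?_
          (reach_of_slice w ?_ ?_)
        · refine ext_slice ?_ ?_
          · rw [slice_liftMat_mulVec, slice_real, hAy]
            funext u
            simp [slice, real]
          · rw [slice_liftMat_mulVec, slice_real, hA1]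
            funext u
            simp [slice, real]
        · have : slice 0 (fun v : Vec (m + 1) => if v 0 = 0 then y (Fin.tail v)
              else frameVec 0 (Fin.tail v)) = y := by
            funext u; simp [slice]
          rw [this]
          exact hw
        · funext u; simp [slice]

/-! ### The stabiliser of a frame vector. -/

theorem frameVec_mem {m : ℕ} (a : Vec m) : frameVec a ∈ lat m := by
  rw [← frameVec_translate]
  exact comp_mem_lat (translate_mem_affFun a) frameVec_zero_mem

/-- The coefficient of √2 on the left counts the zeros among four bits; divisibility by 2 makes this
count even. -/
theorem sum_eq_zero_of_zeroVal {a b c d : ZMod 2} {r : ZS}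
    (h : zeroVal a + zeroVal b + (zeroVal c + zeroVal d) = 2 * r) : a + b + (c + d) = 0 := by
  have him := congrArg Zsqrtd.im h
  have h2 : (2 * r).im = 2 * r.im := by
    rw [Zsqrtd.im_mul]; simp
  rw [h2] at him
  have h3 : (zeroVal a + zeroVal b + (zeroVal c + zeroVal d)).im % 2 = 0 := by omega
  clear h h2 him r
  revert a b c d; decide

/-- The left side is 8 minus twice the number of ones, and the rational part of 2√2·r is a multiple
of 4, so the number of ones is even. -/
theorem sum_eq_zero_of_signVal {a b c d a' b' c' d' : ZMod 2} {r : ZS}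
    (h : signVal a + signVal b + (signVal c + signVal d) +
      (signVal a' + signVal b' + (signVal c' + signVal d')) = 2 * Zsqrtd.sqrtd * r) :
    a + b + (c + d) + (a' + b' + (c' + d')) = 0 := by
  have hre := congrArg Zsqrtd.re h
  have h2 : (2 * Zsqrtd.sqrtd * r).re = 4 * r.im := by
    simp [Zsqrtd.re_mul, Zsqrtd.im_mul]
  rw [h2] at hre
  have h3 : (signVal a + signVal b + (signVal c + signVal d) +
      (signVal a' + signVal b' + (signVal c' + signVal d'))).re % 4 = 0 := by omega
  clear h h2 hre r
  revert a b c d a' b' c' d'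
  decide

/-- Applying the inverse matrix to the constant 1 puts (-1)^f in the lattice; multiplying by that
sign puts each √2-indicator composed with π there too. Sums over 2-flats then show π affine, and
sums over 3-flats show f quadratic. -/
theorem gen_of_signedPerm_isClifford {m : ℕ} {π : Vec m ≃ Vec m} {f : Vec m → ZMod 2}
    (h : IsClifford (signedPerm π f)) : Gen (signedPerm π f) := by
  have key : ∀ x ∈ lat m, signFun f * (x ∘ π) ∈ lat m := by
    intro x hx
    rw [← real_mem_wall_iff, ← h.2]
    have : signedPerm π f *ᵥ real (signFun f * (x ∘ π)) = real x := by
      funext w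
      obtain ⟨w, rfl⟩ := π.surjective w
      rw [signedPerm_mulVec]
      simp only [real, Pi.mul_apply, signFun, map_mul, toR_signVal, Function.comp_apply]
      rw [← mul_assoc, signR_mul_self, one_mul]
    rw [this]
    exact real_mem_wall_iff.2 hx
  have hsign : signFun f ∈ lat m := by
    have := key 1 (one_mem _)
    have h1 : signFun f * ((1 : Vec m → ZS) ∘ π) = signFun f := by
      funext v; simp
    rwa [h1] at this
  have hss : signFun f * signFun f = 1 := by
    funext v
    have : ∀ a, signVal a * signVal a = 1 := by decide
    exact this (f v)
  refine Gen.signedPerm π f (fun a b c => ?_) fun a b c v => ?_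
  · funext t
    have h1 := mul_mem hsign (key _ (zeroInd_coord_mem t))
    rw [← mul_assoc, hss, one_mul] at h1
    -- The flat through a with directions a + b and a + c consists of a, b, c and a + b + c.
    obtain ⟨y, -, hy⟩ := exists_sum_two_flat (a + b) (a + c) h1
    have h2 := sum_eq_zero_of_zeroVal (hy a)
    have e1 : a + (a + b) = b := by rw [← add_assoc, vec_add_self, zero_add]
    have e2 : a + (a + c) = c := by rw [← add_assoc, vec_add_self, zero_add]
    have e3 : c + (a + b) = a + b + c := by abel
    rw [e1, e2, e3] at h2
    simp only [Pi.add_apply]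
    change π a t + π b t + (π c t + π (a + b + c) t) = 0 at h2
    generalize π (a + b + c) t = x1 at *
    generalize π a t = x2 at *
    generalize π b t = x3 at *
    generalize π c t = x4 at *
    revert h2
    clear * -
    revert x1 x2 x3 x4
    decide
  · obtain ⟨r, hr⟩ := exists_sum_three_flat a b c v hsign
    exact sum_eq_zero_of_signVal hr

/-- All frame vectors are translates of one another, hence congruent modulo √2. Their images are
minimal and congruent to the fixed `frameVec 0`, so they are frame vectors up to sign and A is a
signed permutation matrix. -/
theorem gen_of_fix {m : ℕ} {A : Matrix (Vec m) (Vec m) ℝ} (hA : IsClifford A)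
    (hfix : A *ᵥ real (frameVec 0) = real (frameVec 0)) : Gen A := by
  have hs : Real.sqrt 2 ^ m ≠ 0 := by positivity
  have key : ∀ a, ∃ w : Vec m, ∃ ε : ZMod 2, ∀ u, A u a = if u = w then signR ε else 0 := by
    intro a
    obtain ⟨b, hb, hAb, hnb⟩ := hA.exists_real (frameVec_mem a)
    obtain ⟨y, hy, hay⟩ := exists_translate_sub a (frameVec_zero_mem (m := m))
    obtain ⟨z, hz, hyz, -⟩ := hA.exists_real hy
    rw [frameVec_translate] at hay
    obtain ⟨w, hw⟩ := exists_eq_frameVec hb (by rw [hnb, nrm_frameVec]) ⟨z, hz, by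
      apply real_injective
      rw [real_sqrtd_smul, ← hyz, ← mulVec_smul, ← real_sqrtd_smul, ← hay, real_sub,
        real_sub, mulVec_sub, hAb, hfix]⟩
    have hcol : ∀ u, A u a * Real.sqrt 2 ^ m = real b u := by
      intro u
      rw [← hAb]
      simp only [mulVec, dotProduct]
      rw [Finset.sum_eq_single a]
      · simp [real, frameVec, toR_sqrtd]
      · intro v _ hv
        simp [real, frameVec, hv]
      · simp
    rcases hw with rfl | rfl
    · refine ⟨w, 0, fun u => mul_right_cancel₀ hs ?_⟩
      rw [hcol]
      by_cases h : u = w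
      · subst h; simp [real, frameVec, toR_sqrtd, signR_zero]
      · simp [real, frameVec, h]
    · refine ⟨w, 1, fun u => mul_right_cancel₀ hs ?_⟩
      rw [hcol]
      by_cases h : u = w
      · subst h; simp [real, frameVec, toR_sqrtd, signR_one]
      · simp [real, frameVec, h]
  choose π f hπf using key
  have hinj : Function.Injective π := by
    intro v w hvw
    by_contra hne
    have h1 := congrFun (congrFun ((Matrix.mem_orthogonalGroup_iff' _ _).1 hA.1) v) w
    rw [Matrix.one_apply_ne hne, Matrix.mul_apply, Finset.sum_eq_single (π v)] at h1
    · simp only [Matrix.transpose_apply, hπf, hvw, if_true] at h1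
      exact mul_ne_zero (signR_ne_zero _) (signR_ne_zero _) h1
    · intro u _ hu
      simp [hπf, hu]
    · simp
  have hAeq : A = signedPerm (Equiv.ofBijective π (Finite.injective_iff_bijective.1 hinj)) f := by
    ext u v
    simp [signedPerm, hπf]
  rw [hAeq] at hA ⊢
  exact gen_of_signedPerm_isClifford hA

/-- An element of the Clifford group becomes a generated matrix after multiplication with some
generated matrix. -/
theorem exists_gen_mul_gen {m : ℕ} {A : Matrix (Vec m) (Vec m) ℝ} (hA : IsClifford A) :
    ∃ B, Gen B ∧ Gen (B * A) := by
  obtain ⟨y, hy, hAy, hn⟩ := hA.exists_real (frameVec_zero_mem (m := m))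
  obtain ⟨B, hB, hBy⟩ := reach_of_nrm hy (by rw [hn, nrm_frameVec])
  exact ⟨B, hB, gen_of_fix (hB.isClifford.mul hA) (by rw [← mulVec_mulVec, hAy, hBy])⟩

/-! ### Tensors, and the invariance of code indicators. -/

/-- The polynomial `∑_z a_z ∏_i x_{z i}`. -/
noncomputable def poly {m n : ℕ} : ((Fin n → Vec m) → ℝ) →ₗ[ℝ] MvPolynomial (Vec m) ℝ :=
  ∑ z, (LinearMap.proj z).smulRight (∏ i, X (z i))

theorem poly_apply {m n : ℕ} (a : (Fin n → Vec m) → ℝ) :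
    poly a = ∑ z, a z • ∏ i, (X (z i) : MvPolynomial (Vec m) ℝ) := by
  simp [poly]

/-- The action of a matrix on tensors of degree `n`. -/
noncomputable def act {m : ℕ} (n : ℕ) (A : Matrix (Vec m) (Vec m) ℝ) :
    ((Fin n → Vec m) → ℝ) →ₗ[ℝ] ((Fin n → Vec m) → ℝ) :=
  (Matrix.of fun z w : Fin n → Vec m => ∏ i, A (w i) (z i)).mulVecLin

theorem act_apply {m n : ℕ} (A : Matrix (Vec m) (Vec m) ℝ) (a : (Fin n → Vec m) → ℝ)
    (z : Fin n → Vec m) : act n A a z = ∑ w, a w * ∏ i, A (w i) (z i) := by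
  simp [act, mulVec, dotProduct, mul_comm]

theorem subst_poly {m n : ℕ} (A : Matrix (Vec m) (Vec m) ℝ) (a : (Fin n → Vec m) → ℝ) :
    subst A (poly a) = poly (act n A a) := by
  have h : ∀ w : Fin n → Vec m, subst A (∏ i, (X (w i) : MvPolynomial (Vec m) ℝ)) =
      ∑ z : Fin n → Vec m, (∏ i, A (w i) (z i)) • ∏ i, (X (z i) : MvPolynomial (Vec m) ℝ) := by
    intro w
    rw [map_prod]
    simp only [subst, aeval_X]
    rw [Finset.prod_univ_sum, Fintype.piFinset_univ]
    refine Finset.sum_congr rfl fun z _ => ?_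
    rw [Finset.prod_mul_distrib, ← map_prod, smul_eq_C_mul]
  simp only [poly_apply, map_sum, map_smul, h, act_apply, Finset.sum_smul, Finset.smul_sum,
    smul_smul]
  exact Finset.sum_comm

theorem subst_mul {m : ℕ} (A B : Matrix (Vec m) (Vec m) ℝ) (p : MvPolynomial (Vec m) ℝ) :
    subst (A * B) p = subst B (subst A p) := by
  have : subst (A * B) = (subst B).comp (subst A) := by
    refine MvPolynomial.algHom_ext fun u => ?_
    simp only [subst, aeval_X, AlgHom.comp_apply, map_sum, map_mul, algHom_C, algebraMap_eq,
      Matrix.mul_apply, Finset.mul_sum, Finset.sum_mul]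
    rw [Finset.sum_comm]
    exact Finset.sum_congr rfl fun _ _ => Finset.sum_congr rfl fun _ _ => by ring
  rw [this]; rfl

open Classical in
/-- The indicator function of the words all of whose coordinate rows belong to `D`. -/
noncomputable def codeInd {n : ℕ} (m : ℕ) (D : Submodule (ZMod 2) (Vec n)) :
    (Fin n → Vec m) → ℝ := fun z => if ∀ t, (fun i => z i t) ∈ D then 1 else 0

theorem signR_sum {ι : Type*} (s : Finset ι) (g : ι → ZMod 2) :
    ∏ i ∈ s, signR (g i) = signR (∑ i ∈ s, g i) := by
  classical
  induction s using Finset.induction_on with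
  | empty => simp [signR_zero]
  | insert a s ha ih => rw [Finset.prod_insert ha, Finset.sum_insert ha, signR_add, ih]

theorem act_signedPerm {m n : ℕ} (π : Vec m ≃ Vec m) (f : Vec m → ZMod 2)
    (a : (Fin n → Vec m) → ℝ) (z : Fin n → Vec m) :
    act n (signedPerm π f) a z = a (fun i => π (z i)) * signR (∑ i, f (z i)) := by
  rw [act_apply, Finset.sum_eq_single fun i => π (z i)]
  · simp [signedPerm, signR_sum]
  · intro w _ hw
    obtain ⟨i, hi⟩ := Function.ne_iff.1 hw
    rw [Finset.prod_eq_zero (Finset.mem_univ i), mul_zero]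
    simp [signedPerm, hi]
  · simp

/-- The orthogonal complement of a code. -/
def dualCode {n : ℕ} (D : Submodule (ZMod 2) (Vec n)) : Submodule (ZMod 2) (Vec n) where
  carrier := {v | ∀ w ∈ D, v ⬝ᵥ w = 0}
  zero_mem' := fun w _ => zero_dotProduct w
  add_mem' := fun h h' w hw => by rw [add_dotProduct, h w hw, h' w hw, add_zero]
  smul_mem' := fun c v h w hw => by rw [smul_dotProduct, h w hw, smul_zero]

theorem mem_dualCode {n : ℕ} {D : Submodule (ZMod 2) (Vec n)} {v : Vec n} :
    v ∈ dualCode D ↔ ∀ w ∈ D, v ⬝ᵥ w = 0 := Iff.rfl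

theorem isSelfDual_iff {n : ℕ} {D : Submodule (ZMod 2) (Vec n)} :
    IsSelfDual D ↔ dualCode D = D :=
  ⟨fun h => SetLike.ext fun v => (h v).symm, fun h v => by rw [← mem_dualCode, h]⟩

theorem finrank_dualCode {n : ℕ} (D : Submodule (ZMod 2) (Vec n)) :
    finrank (ZMod 2) D + finrank (ZMod 2) (dualCode D) = n := by
  let e := dotProductEquiv (ZMod 2) (Fin n)
  have h : (dualCode D).map (e : Vec n →ₗ[ZMod 2] _) = D.dualAnnihilator := by
    ext φ
    simp only [Submodule.mem_map, Submodule.mem_dualAnnihilator]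
    constructor
    · rintro ⟨v, hv, rfl⟩ w hw
      exact hv w hw
    · intro hφ
      refine ⟨e.symm φ, fun w hw => ?_, e.apply_symm_apply φ⟩
      have := hφ w hw
      rw [← e.apply_symm_apply φ] at this
      exact this
  have h2 := Subspace.finrank_add_finrank_dualAnnihilator_eq D
  rw [← h, LinearEquiv.finrank_map_eq] at h2
  simpa using h2

theorem card_code {n : ℕ} (D : Submodule (ZMod 2) (Vec n)) :
    Nat.card D = 2 ^ finrank (ZMod 2) D := by
  have := Fintype.ofFinite D
  rw [Nat.card_eq_fintype_card, Module.card_eq_pow_finrank (K := ZMod 2), ZMod.card]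

open Classical in
theorem sum_signR_dotProduct {n : ℕ} (D : Submodule (ZMod 2) (Vec n)) (v : Vec n) :
    ∑ r : Vec n, (if r ∈ D then signR (r ⬝ᵥ v) else 0) =
      if v ∈ dualCode D then 2 ^ finrank (ZMod 2) D else 0 := by
  by_cases h : v ∈ dualCode D
  · rw [if_pos h]
    have h1 : ∀ r : Vec n, (if r ∈ D then signR (r ⬝ᵥ v) else 0) = if r ∈ D then (1 : ℝ) else 0 := by
      intro r
      refine if_ctx_congr Iff.rfl (fun hr => ?_) fun _ => rfl
      rw [dotProduct_comm, h r hr, signR_zero]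
    rw [Finset.sum_congr rfl fun r _ => h1 r, Finset.sum_boole]
    have := card_code D
    rw [Nat.card_eq_fintype_card, Fintype.card_subtype] at this
    rw [this]
    norm_cast
  · rw [if_neg h]
    rw [mem_dualCode] at h
    push Not at h
    obtain ⟨c, hc, hvc⟩ := h
    have hvc : c ⬝ᵥ v = 1 := by
      rw [dotProduct_comm]
      exact (zmod_two_cases _).resolve_left hvc
    -- Translation by a codeword c with c·v = 1 permutes D and flips every sign, so the sum is its
    -- own negative.
    have h1 : ∑ r : Vec n, (if r ∈ D then signR (r ⬝ᵥ v) else 0) =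
        ∑ r : Vec n, -(if r ∈ D then signR (r ⬝ᵥ v) else 0) := by
      rw [← Equiv.sum_comp (Equiv.addRight c)]
      refine Finset.sum_congr rfl fun r _ => ?_
      rw [Equiv.coe_addRight, add_dotProduct, hvc, signR_add, signR_one,
        D.add_mem_iff_left hc]
      split_ifs <;> simp
    rw [Finset.sum_neg_distrib] at h1
    linarith

open Classical in
theorem codeInd_eq_prod {m n : ℕ} (D : Submodule (ZMod 2) (Vec n)) (z : Fin n → Vec m) :
    codeInd m D z = ∏ t, if (fun i => z i t) ∈ D then (1 : ℝ) else 0 := by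
  rw [codeInd, Finset.prod_ite_zero]
  simp

-- A word is a list of m rows, and both the Kronecker product and the indicator factor over the
-- rows, so the sum over words becomes a product of sums over single rows.
open Classical in
theorem act_kron_codeInd {m n : ℕ} (B : Fin m → Matrix (ZMod 2) (ZMod 2) ℝ)
    (D : Submodule (ZMod 2) (Vec n)) (z : Fin n → Vec m) :
    act n (kron B) (codeInd m D) z =
      ∏ t, ∑ r : Vec n, if r ∈ D then ∏ i, B t (r i) (z i t) else 0 := by
  rw [act_apply, Finset.prod_univ_sum, Fintype.piFinset_univ]
  rw [← (Equiv.piComm fun (_ : Fin n) (_ : Fin m) => ZMod 2).sum_comp]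
  refine Finset.sum_congr rfl fun w _ => ?_
  simp only [kron, Matrix.of_apply, codeInd_eq_prod]
  rw [Finset.prod_comm, ← Finset.prod_mul_distrib]
  refine Finset.prod_congr rfl fun t _ => ?_
  rw [ite_mul, one_mul, zero_mul]
  rfl

-- This is the MacWilliams transform in row t: D is replaced by its dual there and the other rows
-- are untouched.
open Classical in
theorem act_hadAt_codeInd {m n : ℕ} (t : Fin m) (D : Submodule (ZMod 2) (Vec n))
    (z : Fin n → Vec m) :
    act n (hadAt t) (codeInd m D) z = (Real.sqrt 2)⁻¹ ^ n * 2 ^ finrank (ZMod 2) D *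
      if (∀ s ≠ t, (fun i => z i s) ∈ D) ∧ (fun i => z i t) ∈ dualCode D then 1 else 0 := by
  have hne : ∀ s ≠ t, (∑ r : Vec n, if r ∈ D then
      ∏ i, (if s = t then hadOne else 1 : Matrix (ZMod 2) (ZMod 2) ℝ) (r i) (z i s) else 0) =
      if (fun i => z i s) ∈ D then 1 else 0 := by
    intro s hs
    rw [Finset.sum_eq_single fun i => z i s]
    · simp [hs]
    · intro r _ hr
      obtain ⟨i, hi⟩ := Function.ne_iff.1 hr
      rw [Finset.prod_eq_zero (Finset.mem_univ i), ite_self]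
      simp [hs, hi]
    · simp
  have heq : (∑ r : Vec n, if r ∈ D then
      ∏ i, (if t = t then hadOne else 1 : Matrix (ZMod 2) (ZMod 2) ℝ) (r i) (z i t) else 0) =
      (Real.sqrt 2)⁻¹ ^ n *
        if (fun i => z i t) ∈ dualCode D then 2 ^ finrank (ZMod 2) D else 0 := by
    rw [← sum_signR_dotProduct, Finset.mul_sum]
    refine Finset.sum_congr rfl fun r _ => ?_
    simp only [if_true, hadOne, Matrix.of_apply, Finset.prod_mul_distrib, Finset.prod_const,
      signR_sum, mul_ite, mul_zero, Finset.card_univ, Fintype.card_fin]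
    rfl
  rw [hadAt, act_kron_codeInd, ← Finset.mul_prod_erase _ _ (Finset.mem_univ t), heq,
    Finset.prod_congr rfl fun s hs => hne s (Finset.ne_of_mem_erase hs), Finset.prod_ite_zero]
  have : (∀ s ∈ Finset.univ.erase t, (fun i => z i s) ∈ D) ↔ ∀ s ≠ t, (fun i => z i s) ∈ D := by
    simp
  simp only [this]
  by_cases h1 : ∀ s ≠ t, (fun i => z i s) ∈ D <;>
    by_cases h2 : (fun i => z i t) ∈ dualCode D <;> simp [h1, h2]

theorem aff_comp_mem {m n : ℕ} {D : Submodule (ZMod 2) (Vec n)} (h1 : (1 : Vec n) ∈ D)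
    {z : Fin n → Vec m} (hz : ∀ t, (fun i => z i t) ∈ D) {g : Vec m → ZMod 2}
    (hg : g ∈ affFun m) : (fun i => g (z i)) ∈ D := by
  refine Submodule.span_induction (p := fun g _ => (fun i => g (z i)) ∈ D) ?_ ?_ ?_ ?_ hg
  · rintro _ (rfl | ⟨t, rfl⟩)
    · exact h1
    · exact hz t
  · exact zero_mem D
  · intro f g _ _ hf hg; exact add_mem hf hg
  · intro r f _ hf; exact D.smul_mem r hf

/-- A quadratic f is a sum of products gh of affine functions, and ∑ g(z_i)h(z_i) is the inner
product of two codewords of D. -/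
theorem sum_quad_eq_zero {m n : ℕ} {D : Submodule (ZMod 2) (Vec n)} (h1 : (1 : Vec n) ∈ D)
    (hD : D ≤ dualCode D) {z : Fin n → Vec m} (hz : ∀ t, (fun i => z i t) ∈ D)
    {f : Vec m → ZMod 2} (hf : IsQuad f) : ∑ i, f (z i) = 0 := by
  refine Submodule.mul_induction_on (C := fun f => ∑ i, f (z i) = 0) hf.mem ?_ ?_
  · intro f hf g hg
    exact hD (aff_comp_mem h1 hz hf) _ (aff_comp_mem h1 hz hg)
  · intro f g hf hg
    simp only [Pi.add_apply, Finset.sum_add_distrib, hf, hg, add_zero]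

theorem codeInd_affine {m n : ℕ} {D : Submodule (ZMod 2) (Vec n)} (h1 : (1 : Vec n) ∈ D)
    {π : Vec m ≃ Vec m} (hπ : IsAffine π) (z : Fin n → Vec m) :
    codeInd m D (fun i => π (z i)) = codeInd m D z := by
  classical
  refine if_congr ⟨fun h t => ?_, fun h t => ?_⟩ rfl rfl
  · simpa using aff_comp_mem h1 h (hπ.symm.coord_mem t)
  · exact aff_comp_mem h1 h (hπ.coord_mem t)

/-- Over 𝔽₂ one has 1·w = w·w. -/
theorem one_mem_of_isSelfDual {n : ℕ} {D : Submodule (ZMod 2) (Vec n)} (hD : IsSelfDual D) :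
    (1 : Vec n) ∈ D := by
  refine (hD 1).2 fun w hw => ?_
  rw [← (hD w).1 hw w hw]
  refine Finset.sum_congr rfl fun i _ => ?_
  change 1 * w i = w i * w i
  generalize w i = a
  revert a; decide

theorem Gen.subst_codeInd {m n : ℕ} {A : Matrix (Vec m) (Vec m) ℝ} (hA : Gen A)
    {D : Submodule (ZMod 2) (Vec n)} (hD : IsSelfDual D) :
    subst A (poly (codeInd m D)) = poly (codeInd m D) := by
  classical
  have h1 := one_mem_of_isSelfDual hD
  have hdual := isSelfDual_iff.1 hD
  induction hA with
  | signedPerm π f hπ hf =>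
    rw [subst_poly]
    congr 1
    funext z
    rw [act_signedPerm, codeInd_affine h1 hπ]
    by_cases hz : ∀ t, (fun i => z i t) ∈ D
    · rw [sum_quad_eq_zero h1 hdual.ge hz hf, signR_zero, mul_one]
    · simp [codeInd, hz]
  | hadAt t =>
    rw [subst_poly]
    congr 1
    funext z
    rw [act_hadAt_codeInd, hdual]
    have h2 := finrank_dualCode D
    rw [hdual, ← two_mul] at h2
    -- A self-dual code has dimension n/2, which is exactly what cancels the normalisation of the
    -- Hadamard matrix.
    have h3 : (Real.sqrt 2)⁻¹ ^ n * 2 ^ finrank (ZMod 2) D = 1 := by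
      have h4 : (Real.sqrt 2)⁻¹ ^ n = (Real.sqrt 2)⁻¹ ^ (2 * finrank (ZMod 2) D) :=
        congrArg _ h2.symm
      rw [h4, pow_mul, inv_pow, Real.sq_sqrt (by norm_num), inv_pow,
        inv_mul_cancel₀ (by positivity)]
    rw [h3, one_mul, codeInd]
    refine if_congr ⟨fun h s => ?_, fun h => ⟨fun s _ => h s, h t⟩⟩ rfl rfl
    by_cases hs : s = t
    · exact hs ▸ h.2
    · exact h.1 s hs
  | mul _ _ hA hB => rw [subst_mul, hA, hB]

/-- Some B and BA are both generated; each fixes the polynomial, hence so does A. -/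
theorem IsClifford.subst_codeInd {m n : ℕ} {A : Matrix (Vec m) (Vec m) ℝ} (hA : IsClifford A)
    {D : Submodule (ZMod 2) (Vec n)} (hD : IsSelfDual D) :
    subst A (poly (codeInd m D)) = poly (codeInd m D) := by
  obtain ⟨B, hB, hBA⟩ := exists_gen_mul_gen hA
  have h := hBA.subst_codeInd hD
  rwa [subst_mul, hB.subst_codeInd hD] at h

/-! ### Weight enumerators as indicators of rows. -/

theorem mem_extendScalars_iff {F : Type*} [Field F] [Algebra (ZMod 2) F] {m n : ℕ}
    (b : Basis (Fin m) (ZMod 2) F) (D : Submodule (ZMod 2) (Vec n)) (c : Fin n → F) :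
    c ∈ extendScalars F D ↔ ∀ t, (fun i => b.equivFun (c i) t) ∈ D := by
  constructor
  · intro hc
    refine Submodule.span_induction
      (p := fun c _ => ∀ t, (fun i => b.equivFun (c i) t) ∈ D) ?_ ?_ ?_ ?_ hc
    · rintro _ ⟨d, hd, rfl⟩ t
      have : (fun i => b.equivFun (algebraMap (ZMod 2) F (d i)) t) = b.equivFun 1 t • d := by
        funext i
        rw [Algebra.algebraMap_eq_smul_one, map_smul]
        simp [mul_comm]
      simp only [this]
      exact D.smul_mem _ hd
    · intro t
      convert zero_mem D using 1
      funext i; simp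
    · intro x y _ _ hx hy t
      convert add_mem (hx t) (hy t) using 1
      funext i; simp
    · intro a x _ hx t
      -- Multiplication by a is 𝔽₂-linear, so the new rows are 𝔽₂-combinations of the old ones.
      have : (fun i => b.equivFun ((a • x) i) t)
          = ∑ s, b.equivFun (a * b s) t • fun i => b.equivFun (x i) s := by
        funext i
        rw [Finset.sum_apply]
        conv_lhs => rw [Pi.smul_apply, smul_eq_mul, ← b.sum_equivFun (x i), Finset.mul_sum]
        rw [map_sum, Finset.sum_apply]
        refine Finset.sum_congr rfl fun s _ => ?_
        rw [mul_smul_comm, map_smul, Pi.smul_apply, Pi.smul_apply, smul_eq_mul, smul_eq_mul,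
          mul_comm]
      rw [this]
      exact sum_mem fun s _ => D.smul_mem _ (hx s)
  · intro h
    have : c = ∑ t, b t • fun i => algebraMap (ZMod 2) F (b.equivFun (c i) t) := by
      funext i
      rw [Finset.sum_apply]
      conv_lhs => rw [← b.sum_equivFun (c i)]
      refine Finset.sum_congr rfl fun t _ => ?_
      rw [Pi.smul_apply, smul_eq_mul, mul_comm, Algebra.smul_def]
    rw [this]
    exact sum_mem fun t _ => Submodule.smul_mem _ _ (Submodule.subset_span ⟨_, h t, rfl⟩)

theorem cwe_eq {m n : ℕ} (b : Basis (Fin m) (ZMod 2) (GaloisField 2 m)) (D : SelfDualCode n) :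
    cwe b D = poly (codeInd m D.1) := by
  classical
  rw [cwe, completeWeightEnumerator, map_sum, poly_apply]
  simp only [codeInd, ite_smul, one_smul, zero_smul, map_prod, rename_X]
  rw [← Finset.sum_filter]
  refine Finset.sum_bij (fun c _ i => b.equivFun (c i)) ?_ ?_ ?_ ?_
  · intro c hc
    rw [Set.Finite.mem_toFinset] at hc
    simpa using (mem_extendScalars_iff b D.1 c).1 hc
  · intro c _ c' _ h
    funext i
    exact b.equivFun.injective (congrFun h i)
  · intro z hz
    refine ⟨fun i => b.equivFun.symm (z i), ?_, funext fun i => b.equivFun.apply_symm_apply (z i)⟩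
    rw [Set.Finite.mem_toFinset]
    refine (mem_extendScalars_iff b D.1 _).2 ?_
    simp only [LinearEquiv.apply_symm_apply]
    simpa using hz
  · intro c _
    rfl

theorem poly_isHomogeneous {m n : ℕ} (a : (Fin n → Vec m) → ℝ) : (poly a).IsHomogeneous n := by
  rw [poly_apply]
  refine IsHomogeneous.sum _ _ _ fun z _ => ?_
  have h : (∏ i, (X (z i) : MvPolynomial (Vec m) ℝ)).IsHomogeneous n := by
    simpa using IsHomogeneous.prod Finset.univ (fun i => (X (z i) : MvPolynomial (Vec m) ℝ))
      (fun _ => 1) fun i _ => isHomogeneous_X _ _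
  exact (homogeneousSubmodule _ ℝ n).smul_mem _ h

theorem mem_homogeneousInvariants_iff {m d : ℕ} {p : MvPolynomial (Vec m) ℝ} :
    p ∈ homogeneousInvariants m d ↔ p.IsHomogeneous d ∧
      ∀ A : Matrix (Vec m) (Vec m) ℝ, IsClifford A → subst A p = p :=
  ⟨fun h => ⟨h.1, fun A hA => h.2 ⟨A, hA.1⟩ hA.2⟩, fun h => ⟨h.1, fun g hg => h.2 g ⟨g.2, hg⟩⟩⟩

theorem cwe_mem {m n : ℕ} (b : Basis (Fin m) (ZMod 2) (GaloisField 2 m)) (D : SelfDualCode n) :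
    cwe b D ∈ homogeneousInvariants m n := by
  rw [cwe_eq]
  exact mem_homogeneousInvariants_iff.2 ⟨poly_isHomogeneous _, fun A hA => hA.subst_codeInd D.2⟩

/-! ### Affine orbits of words and the codes they generate. -/

theorem exists_linearEquiv_map_eq {m n : ℕ} {z z' : Fin n → Vec m}
    (h : ∀ c : Vec n, ∑ i, c i • z i = 0 ↔ ∑ i, c i • z' i = 0) :
    ∃ g : Vec m ≃ₗ[ZMod 2] Vec m, ∀ i, g (z i) = z' i := by
  let f := Fintype.linearCombination (ZMod 2) z
  let f' := Fintype.linearCombination (ZMod 2) z'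
  have hker : LinearMap.ker f = LinearMap.ker f' := by
    ext c
    simpa [f, f', Fintype.linearCombination_apply] using h c
  -- Equal relation spaces give an isomorphism between the two spans, which extends to the ambient
  -- space.
  let e := f.quotKerEquivRange.symm ≪≫ₗ Submodule.quotEquivOfEq _ _ hker ≪≫ₗ f'.quotKerEquivRange
  obtain ⟨g, hg⟩ := Submodule.exists_linearEquiv_restrict_eq e
  refine ⟨g, fun i => ?_⟩
  have h1 : z i = f (Pi.single i 1) := by simp [f]
  have h2 : z' i = f' (Pi.single i 1) := by simp [f']
  have h3 := hg ⟨f (Pi.single i 1), LinearMap.mem_range_self _ _⟩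
  have h4 : f.quotKerEquivRange.symm ⟨f (Pi.single i 1), LinearMap.mem_range_self _ _⟩
      = Submodule.Quotient.mk (Pi.single i 1) := by
    rw [LinearEquiv.symm_apply_eq]
    rfl
  rw [h1, h2, ← h3]
  simp only [e, LinearEquiv.trans_apply, h4]
  rfl

/-- The code generated by the all-ones word and the coordinate rows of `z`. -/
def genCode {m n : ℕ} (z : Fin n → Vec m) : Submodule (ZMod 2) (Vec n) :=
  Submodule.span (ZMod 2) (insert 1 (Set.range fun t i => z i t))

theorem genCode_le_iff {m n : ℕ} {z : Fin n → Vec m} {D : Submodule (ZMod 2) (Vec n)} :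
    genCode z ≤ D ↔ 1 ∈ D ∧ ∀ t, (fun i => z i t) ∈ D := by
  rw [genCode, Submodule.span_le, Set.insert_subset_iff, Set.range_subset_iff]
  rfl

theorem one_mem_genCode {m n : ℕ} (z : Fin n → Vec m) : (1 : Vec n) ∈ genCode z :=
  (genCode_le_iff.1 le_rfl).1

theorem row_mem_genCode {m n : ℕ} (z : Fin n → Vec m) (t : Fin m) :
    (fun i => z i t) ∈ genCode z :=
  (genCode_le_iff.1 le_rfl).2 t

/-- Translating each word so that its first entry is 0 makes all rows vanish at position 0; a
combination involving the all-ones word would not, so that word drops out. -/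
theorem row_mem_span_of_genCode_eq {m n : ℕ} {z z' : Fin (n + 1) → Vec m}
    (h : genCode z = genCode z') (t : Fin m) :
    (fun i => (z' i + z' 0) t) ∈
      Submodule.span (ZMod 2) (Set.range fun t i => (z i + z 0) t) := by
  set R := Submodule.span (ZMod 2) (Set.range fun t i => (z i + z 0) t) with hR
  have h1 : genCode z ≤ Submodule.span (ZMod 2) (insert 1 (Set.range fun t i => (z i + z 0) t)) := by
    refine genCode_le_iff.2 ⟨Submodule.subset_span (Set.mem_insert _ _), fun s => ?_⟩
    have : (fun i => z i s) = (fun i => (z i + z 0) s) + z 0 s • (1 : Vec (n + 1)) := by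
      funext i
      simp [add_assoc, CharTwo.add_self_eq_zero]
    rw [this]
    exact add_mem (Submodule.subset_span (Set.mem_insert_of_mem _ ⟨s, rfl⟩))
      (Submodule.smul_mem _ _ (Submodule.subset_span (Set.mem_insert _ _)))
  have h2 : (fun i => (z' i + z' 0) t) ∈ genCode z := by
    rw [h]
    have : (fun i => (z' i + z' 0) t) = (fun i => z' i t) + z' 0 t • (1 : Vec (n + 1)) := by
      funext i; simp
    rw [this]
    exact add_mem (row_mem_genCode z' t) (Submodule.smul_mem _ _ (one_mem_genCode z'))
  obtain ⟨a, r, hr, hra⟩ := Submodule.mem_span_insert.1 (h1 h2)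
  have hr0 : r 0 = 0 := by
    have : R ≤ LinearMap.ker (LinearMap.proj (R := ZMod 2) (φ := fun _ : Fin (n + 1) => ZMod 2) 0) := by
      rw [hR, Submodule.span_le, Set.range_subset_iff]
      intro s
      simp [CharTwo.add_self_eq_zero]
    exact this hr
  have ha := congrFun hra 0
  simp only [Pi.add_apply, Pi.smul_apply, Pi.one_apply, hr0, CharTwo.add_self_eq_zero, smul_eq_mul,
    mul_one, add_zero] at ha
  rw [hra, ← ha, zero_smul, zero_add]
  exact hr

/-- Words generating the same code are related by an affine permutation. -/
theorem exists_affine_of_genCode_eq {m n : ℕ} {z z' : Fin n → Vec m}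
    (h : genCode z = genCode z') :
    ∃ π : Vec m ≃ Vec m, IsAffine π ∧ ∀ i, π (z i) = z' i := by
  cases n with
  | zero => exact ⟨Equiv.refl _, fun _ _ _ => rfl, fun i => i.elim0⟩
  | succ n =>
    -- The linear relations among the translated entries are the words orthogonal to the row space,
    -- so they depend only on that space.
    have key : ∀ {z z' : Fin (n + 1) → Vec m}, genCode z = genCode z' → ∀ c : Vec (n + 1),
        ∑ i, c i • (z i + z 0) = 0 → ∑ i, c i • (z' i + z' 0) = 0 := by
      intro z z' h c hc
      funext t
      have h1 : ∀ r ∈ Submodule.span (ZMod 2) (Set.range fun t i => (z i + z 0) t),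
          c ⬝ᵥ r = 0 := by
        intro r hr
        refine Submodule.span_induction (p := fun r _ => c ⬝ᵥ r = 0) ?_ (dotProduct_zero c)
          (fun x y _ _ hx hy => by rw [dotProduct_add, hx, hy, add_zero])
          (fun a x _ hx => by rw [dotProduct_smul, hx, smul_zero]) hr
        rintro _ ⟨s, rfl⟩
        have := congrFun hc s
        simpa [dotProduct, Finset.sum_apply, mul_add] using this
      have h2 := h1 _ (row_mem_span_of_genCode_eq h t)
      simpa [dotProduct, Finset.sum_apply, mul_add] using h2
    obtain ⟨g, hg⟩ := exists_linearEquiv_map_eq (z := fun i => z i + z 0) (z' := fun i => z' i + z' 0)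
      fun c => ⟨key h c, key h.symm c⟩
    refine ⟨(translation (z 0)).trans (g.toEquiv.trans (translation (z' 0))), ?_, fun i => ?_⟩
    · intro a b c
      have h1 := isAffine_translation (z 0) a b c
      have h2 := isAffine_translation (z' 0) (g (translation (z 0) a)) (g (translation (z 0) b))
        (g (translation (z 0) c))
      simp only [Equiv.trans_apply, LinearEquiv.coe_toEquiv, h1, map_add, h2]
    · simp [translation, hg, add_assoc, vec_add_self]

/-- Codes that contain the all-ones word and are contained in their orthogonal complement. -/
def IsSelfOrth {n : ℕ} (D : Submodule (ZMod 2) (Vec n)) : Prop := 1 ∈ D ∧ D ≤ dualCode D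

theorem dualCode_anti {n : ℕ} {D E : Submodule (ZMod 2) (Vec n)} (h : D ≤ E) :
    dualCode E ≤ dualCode D := fun _ hv w hw => hv w (h hw)

theorem codeInd_eq_genCode {m n : ℕ} {D : Submodule (ZMod 2) (Vec n)} (h1 : (1 : Vec n) ∈ D)
    (z : Fin n → Vec m) [Decidable (genCode z ≤ D)] :
    codeInd m D z = if genCode z ≤ D then 1 else 0 := by
  classical
  refine if_congr ?_ rfl rfl
  rw [genCode_le_iff]
  exact ⟨fun h => ⟨h1, h⟩, fun h => h.2⟩

-- Möbius inversion by induction on D: `codeInd m D` is the sum of these exact indicators over the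
-- subcodes of D containing 1, and such subcodes inherit self-orthogonality.
open Classical in
theorem genCodeInd_mem_span {m n : ℕ} (D : Submodule (ZMod 2) (Vec n)) (hD : IsSelfOrth D) :
    (fun z : Fin n → Vec m => if genCode z = D then (1 : ℝ) else 0) ∈
      Submodule.span ℝ (codeInd m '' {D : Submodule (ZMod 2) (Vec n) | IsSelfOrth D}) := by
  induction D using WellFoundedLT.induction with
  | ind D ih =>
    have h : (fun z : Fin n → Vec m => if genCode z = D then (1 : ℝ) else 0) = codeInd m D -
        ∑ E ∈ Finset.univ.filter (fun E => E < D ∧ 1 ∈ E),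
          fun z : Fin n → Vec m => if genCode z = E then (1 : ℝ) else 0 := by
      funext z
      rw [Pi.sub_apply, codeInd_eq_genCode hD.1, Finset.sum_apply, Finset.sum_ite_eq]
      have h1 := one_mem_genCode z
      simp only [Finset.mem_filter, Finset.mem_univ, true_and, h1, and_true]
      by_cases hz : genCode z = D
      · simp [hz]
      · by_cases hle : genCode z ≤ D
        · simp [hz, hle, lt_of_le_of_ne hle hz]
        · have : ¬ genCode z < D := fun h => hle h.le
          simp [hz, hle, this]
    rw [h]
    refine sub_mem (Submodule.subset_span ⟨D, hD, rfl⟩) (sum_mem fun E hE => ?_)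
    obtain ⟨hED, h1⟩ := (Finset.mem_filter.1 hE).2
    exact ih E hED ⟨h1, hED.le.trans (hD.2.trans (dualCode_anti hED.le))⟩

theorem mul_signR_eq {x : ℝ} {a : ZMod 2} (h : x * signR a = x) (hx : x ≠ 0) : a = 0 := by
  rcases zmod_two_cases a with h0 | h1
  · exact h0
  · rw [h1, signR_one] at h
    exact absurd (by linarith) hx

theorem isQuad_mul {m : ℕ} (s t : Fin m) : IsQuad (fun v : Vec m => v s * v t) := by
  intro x y z v
  simp only [Pi.add_apply]
  generalize x t = x1
  generalize y t = y1
  generalize z t = z1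
  generalize v t = v1
  generalize x s = x2
  generalize y s = y2
  generalize z s = z2
  generalize v s = v2
  revert x1 y1 z1 v1 x2 y2 z2 v2; decide

/-- Quadratic signs confine the support of a to words generating self-orthogonal codes, and affine
permutations make a depend only on the generated code. -/
theorem mem_span_codeInd {m n : ℕ} (hn : (n : ZMod 2) = 0) {a : (Fin n → Vec m) → ℝ}
    (ha : ∀ A : Matrix (Vec m) (Vec m) ℝ, Gen A → act n A a = a) :
    a ∈ Submodule.span ℝ (codeInd m '' {D : Submodule (ZMod 2) (Vec n) | IsSelfOrth D}) := by
  classical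
  have hquad : ∀ f : Vec m → ZMod 2, IsQuad f → ∀ z, a z ≠ 0 → ∑ i, f (z i) = 0 := by
    intro f hf z hz
    have h := congrFun (ha _ (Gen.signedPerm (Equiv.refl _) f (fun _ _ _ => rfl) hf)) z
    rw [act_signedPerm] at h
    exact mul_signR_eq h hz
  have haff : ∀ z z' : Fin n → Vec m, genCode z = genCode z' → a z = a z' := by
    intro z z' h
    obtain ⟨π, hπ, hz⟩ := exists_affine_of_genCode_eq h
    have h := congrFun (ha _ (Gen.signedPerm π _ hπ (isQuad_const 0))) z
    rw [act_signedPerm] at h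
    simpa [hz, signR_zero] using h.symm
  have horth : ∀ z, a z ≠ 0 → IsSelfOrth (genCode z) := by
    intro z hz
    -- Orthogonality is tested on generators: 1·1 = n, while 1·row_t and row_s·row_t are the sums
    -- over the word of the quadratic functions v_t and v_s v_t.
    refine ⟨one_mem_genCode z, genCode_le_iff.2 ⟨fun w hw => ?_, fun s w hw => ?_⟩⟩
    · rw [dotProduct_comm]
      refine (genCode_le_iff (D := dualCode (Submodule.span (ZMod 2) {1}))).2
        ⟨fun v hv => ?_, fun t v hv => ?_⟩ hw 1 (Submodule.mem_span_singleton_self _)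
      · obtain ⟨r, rfl⟩ := Submodule.mem_span_singleton.1 hv
        rw [dotProduct_smul]
        simp [dotProduct, hn]
      · obtain ⟨r, rfl⟩ := Submodule.mem_span_singleton.1 hv
        rw [dotProduct_smul]
        have := hquad _ (by simpa using isQuad_coord (m := m) 1 0 t) z hz
        simp only [dotProduct, Pi.one_apply, mul_one]
        rw [this, smul_zero]
    · rw [dotProduct_comm]
      refine (genCode_le_iff (D := dualCode (Submodule.span (ZMod 2) {fun i => z i s}))).2
        ⟨fun v hv => ?_, fun t v hv => ?_⟩ hw _ (Submodule.mem_span_singleton_self _)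
      · obtain ⟨r, rfl⟩ := Submodule.mem_span_singleton.1 hv
        rw [dotProduct_smul]
        have := hquad _ (by simpa using isQuad_coord (m := m) 1 0 s) z hz
        simp only [dotProduct, Pi.one_apply, one_mul]
        rw [this, smul_zero]
      · obtain ⟨r, rfl⟩ := Submodule.mem_span_singleton.1 hv
        rw [dotProduct_smul]
        have := hquad _ (isQuad_mul t s) z hz
        simp only [dotProduct]
        rw [this, smul_zero]
  let α : Submodule (ZMod 2) (Vec n) → ℝ := fun D =>
    if h : ∃ z : Fin n → Vec m, genCode z = D then a h.choose else 0
  have hα : ∀ z, α (genCode z) = a z := by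
    intro z
    have h : ∃ z' : Fin n → Vec m, genCode z' = genCode z := ⟨z, rfl⟩
    simp only [α, dif_pos h]
    exact haff _ _ h.choose_spec
  have hsum : a = ∑ D ∈ Finset.univ.filter (fun D => IsSelfOrth D),
      α D • fun z : Fin n → Vec m => if genCode z = D then (1 : ℝ) else 0 := by
    funext z
    simp only [Finset.sum_apply, Pi.smul_apply, smul_eq_mul, mul_ite, mul_one, mul_zero,
      Finset.sum_ite_eq, Finset.mem_filter, Finset.mem_univ, true_and, hα]
    by_cases hz : a z = 0
    · simp [hz]
    · simp [horth z hz]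
  rw [hsum]
  exact sum_mem fun D hD => Submodule.smul_mem _ _
    (genCodeInd_mem_span D (Finset.mem_filter.1 hD).2)

/-! ### The averaged Hadamard operator and its triangularity. -/

instance finite_linearEquiv_vec {m : ℕ} : Finite (Vec m ≃ₗ[ZMod 2] Vec m) :=
  Finite.of_injective (fun g => (g : Vec m → Vec m)) DFunLike.coe_injective

noncomputable instance fintype_linearEquiv_vec {m : ℕ} : Fintype (Vec m ≃ₗ[ZMod 2] Vec m) :=
  Fintype.ofFinite _

theorem isAffine_linearEquiv {m : ℕ} (g : Vec m ≃ₗ[ZMod 2] Vec m) : IsAffine g.toEquiv :=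
  fun a b c => by simp

open Classical in
/-- The number of linear automorphisms of `𝔽₂^m` that fix the basis vector `e_t`. -/
noncomputable def stabCard {m : ℕ} (t : Fin m) : ℕ :=
  (Finset.univ.filter fun g : Vec m ≃ₗ[ZMod 2] Vec m =>
    g (Pi.single t 1) = Pi.single t 1).card

-- The linear group is transitive on nonzero vectors, so this set is a coset of the stabiliser of
-- e_t.
open Classical in
theorem card_filter_map_eq_single {m : ℕ} (t : Fin m) {u : Vec m} (hu : u ≠ 0) :
    (Finset.univ.filter fun g : Vec m ≃ₗ[ZMod 2] Vec m => g u = Pi.single t 1).card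
      = stabCard t := by
  have he : (Pi.single t 1 : Vec m) ≠ 0 := by simp
  obtain ⟨g₀, hg₀⟩ := exists_linearEquiv_map_eq (z := fun _ : Fin 1 => (Pi.single t 1 : Vec m))
    (z' := fun _ : Fin 1 => u) fun c => by simp [hu]
  have hg₀ : g₀ (Pi.single t 1) = u := hg₀ 0
  refine Finset.card_bij (fun g _ => g₀.trans g) ?_ ?_ ?_
  · intro g hg
    simpa [hg₀] using hg
  · intro g _ g' _ h
    ext1 v
    have := LinearEquiv.congr_fun h (g₀.symm v)
    simpa using this
  · intro g hg
    refine ⟨g₀.symm.trans g, ?_, by ext1 v; simp⟩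
    have : g₀.symm u = Pi.single t 1 := by rw [LinearEquiv.symm_apply_eq, hg₀]
    simpa [this] using hg

theorem linear_comp_add_mem {m n : ℕ} {D : Submodule (ZMod 2) (Vec n)} {z : Fin n → Vec m}
    {u : Vec m} {y : Vec n} (h : ∀ t, (fun i => z i t) + u t • y ∈ D)
    (ℓ : Vec m →ₗ[ZMod 2] ZMod 2) : (fun i => ℓ (z i)) + ℓ u • y ∈ D := by
  have hℓ : ∀ v, ℓ v = ∑ t, v t * ℓ (Pi.single t 1) := by
    intro v
    conv_lhs => rw [pi_eq_sum_univ' v, map_sum]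
    simp
  have : (fun i => ℓ (z i)) + ℓ u • y = ∑ t, ℓ (Pi.single t 1) • ((fun i => z i t) + u t • y) := by
    funext i
    simp only [Pi.add_apply, Pi.smul_apply, smul_eq_mul, Finset.sum_apply]
    rw [hℓ (z i), hℓ u, Finset.sum_mul, ← Finset.sum_add_distrib]
    exact Finset.sum_congr rfl fun t _ => by ring
  rw [this]
  exact sum_mem fun t _ => D.smul_mem _ (h t)

theorem linear_comp_mem {m n : ℕ} {D : Submodule (ZMod 2) (Vec n)} {z : Fin n → Vec m}
    (h : ∀ t, (fun i => z i t) ∈ D) (g : Vec m →ₗ[ZMod 2] Vec m) (t : Fin m) :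
    (fun i => g (z i) t) ∈ D := by
  have := linear_comp_add_mem (D := D) (z := z) (u := 0) (y := 0) (fun t => by simpa using h t)
    ((LinearMap.proj t).comp g)
  simpa using this

theorem mem_sup_singleton_iff {n : ℕ} {D : Submodule (ZMod 2) (Vec n)} {x y : Vec n} :
    x ∈ D ⊔ Submodule.span (ZMod 2) {y} ↔ ∃ r : ZMod 2, x + r • y ∈ D := by
  constructor
  · intro h
    obtain ⟨d, hd, w, hw, rfl⟩ := Submodule.mem_sup.1 h
    obtain ⟨r, rfl⟩ := Submodule.mem_span_singleton.1 hw
    refine ⟨r, ?_⟩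
    rw [add_assoc, vec_add_self, add_zero]
    exact hd
  · rintro ⟨r, hr⟩
    refine Submodule.mem_sup.2 ⟨_, hr, r • y, Submodule.smul_mem _ _
      (Submodule.mem_span_singleton_self y), ?_⟩
    rw [add_assoc, vec_add_self, add_zero]

theorem add_mem_of_mem_sup {n : ℕ} {D : Submodule (ZMod 2) (Vec n)} {x y : Vec n} (hx : x ∉ D)
    (h : x ∈ D ⊔ Submodule.span (ZMod 2) {y}) : x + y ∈ D := by
  obtain ⟨r, hr⟩ := mem_sup_singleton_iff.1 h
  rcases zmod_two_cases r with rfl | rfl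
  · rw [zero_smul, add_zero] at hr; exact absurd hr hx
  · rwa [one_smul] at hr

theorem sup_span_eq_of_add_mem {n : ℕ} {D : Submodule (ZMod 2) (Vec n)} {x y : Vec n}
    (h : x + y ∈ D) : D ⊔ Submodule.span (ZMod 2) {x} = D ⊔ Submodule.span (ZMod 2) {y} := by
  have key : ∀ {x y : Vec n}, x + y ∈ D →
      D ⊔ Submodule.span (ZMod 2) {x} ≤ D ⊔ Submodule.span (ZMod 2) {y} := by
    intro x y h
    refine sup_le le_sup_left ?_
    rw [Submodule.span_singleton_le_iff_mem]
    exact mem_sup_singleton_iff.2 ⟨1, by rwa [one_smul]⟩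
  exact le_antisymm (key h) (key (by rwa [add_comm]))

/-- The words with row `t` in the orthogonal complement of `D` and all other rows in `D`. -/
def IsHadSupp {m n : ℕ} (t : Fin m) (D : Submodule (ZMod 2) (Vec n)) (z : Fin n → Vec m) : Prop :=
  (∀ s ≠ t, (fun i => z i s) ∈ D) ∧ (fun i => z i t) ∈ dualCode D

theorem rows_mem_of_map_rows_mem {m n : ℕ} {E : Submodule (ZMod 2) (Vec n)} {z : Fin n → Vec m}
    (g : Vec m ≃ₗ[ZMod 2] Vec m) (h : ∀ t, (fun i => g (z i) t) ∈ E) (t : Fin m) :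
    (fun i => z i t) ∈ E := by
  simpa using linear_comp_mem h (g.symm : Vec m →ₗ[ZMod 2] Vec m) t

-- Modulo D the rows of z are u_s·r with u ≠ 0, and g turns u into gu. The word gz has its rows
-- outside t in D exactly when gu = e_t, and row t is automatically in the dual.
open Classical in
theorem card_filter_isHadSupp {m n : ℕ} (t : Fin m) {D : Submodule (ZMod 2) (Vec n)}
    (hD : IsSelfOrth D) {z : Fin n → Vec m} {s₀ : Fin m} (hs₀ : (fun i => z i s₀) ∉ D)
    (hr : (fun i => z i s₀) ∈ dualCode D)
    (hz : ∀ s, (fun i => z i s) ∈ D ⊔ Submodule.span (ZMod 2) {fun i => z i s₀}) :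
    (Finset.univ.filter fun g : Vec m ≃ₗ[ZMod 2] Vec m => IsHadSupp t D fun i => g (z i)).card
      = stabCard t := by
  set r : Vec n := fun i => z i s₀ with hrdef
  choose u hu using fun s => mem_sup_singleton_iff.1 (hz s)
  have hu0 : u ≠ 0 := by
    rintro rfl
    apply hs₀
    simpa using hu s₀
  rw [← card_filter_map_eq_single t hu0]
  congr 1
  refine Finset.filter_congr fun g _ => ?_
  have hg : ∀ s, (fun i => g (z i) s) + (g u) s • r ∈ D := fun s =>
    linear_comp_add_mem hu ((LinearMap.proj s).comp (g : Vec m →ₗ[ZMod 2] Vec m))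
  have hiff : ∀ s, (fun i => g (z i) s) ∈ D ↔ g u s = 0 := by
    intro s
    constructor
    · intro h
      by_contra hne
      have h1 := hg s
      rw [(zmod_two_cases _).resolve_left hne, one_smul] at h1
      exact hs₀ ((D.add_mem_iff_right h).1 h1)
    · intro h
      simpa [h] using hg s
  have hdual : ∀ s, (fun i => g (z i) s) ∈ dualCode D := by
    intro s
    have h1 := sub_mem (hD.2 (hg s)) ((dualCode D).smul_mem (g u s) hr)
    rwa [add_sub_cancel_right] at h1
  constructor
  · rintro ⟨h, -⟩
    have hs : ∀ s ≠ t, g u s = 0 := fun s hs => (hiff s).1 (h s hs)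
    funext s
    by_cases hst : s = t
    · subst hst
      rw [Pi.single_eq_same]
      refine (zmod_two_cases _).resolve_left fun h0 => hu0 ?_
      apply g.injective
      rw [map_zero]
      funext s'
      by_cases h' : s' = s
      · rw [h', h0]; rfl
      · exact hs s' h'
    · rw [hs s hst, Pi.single_eq_of_ne hst]
  · intro h
    refine ⟨fun s hs => (hiff s).2 ?_, hdual t⟩
    rw [h, Pi.single_eq_of_ne hs]

-- If all rows lie in D, every g counts. If they span a line modulo D inside the dual, `stabCard t`
-- of them count. Otherwise none do. The factor 2^dim D appears because each code D + ⟨y⟩ arises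
-- from a full coset of choices of y.
open Classical in
theorem card_mul_sum_isHadSupp {m n : ℕ} (t : Fin m) {D : Submodule (ZMod 2) (Vec n)}
    (hD : IsSelfOrth D) (z : Fin n → Vec m) :
    (2 : ℝ) ^ finrank (ZMod 2) D * ∑ g : Vec m ≃ₗ[ZMod 2] Vec m,
        (if IsHadSupp t D (fun i => g (z i)) then 1 else 0) =
      2 ^ finrank (ZMod 2) D * Fintype.card (Vec m ≃ₗ[ZMod 2] Vec m) * codeInd m D z +
      stabCard t * ∑ y ∈ Finset.univ.filter (fun y => y ∈ dualCode D ∧ y ∉ D),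
        (codeInd m (D ⊔ Submodule.span (ZMod 2) {y}) z - codeInd m D z) := by
  by_cases hz : ∀ s, (fun i => z i s) ∈ D
  · have h1 : codeInd m D z = 1 := by simp [codeInd, hz]
    have h2 : ∀ y, codeInd m (D ⊔ Submodule.span (ZMod 2) {y}) z = 1 := by
      intro y
      rw [codeInd, if_pos fun s => (le_sup_left : D ≤ _) (hz s)]
    have h3 : ∀ g : Vec m ≃ₗ[ZMod 2] Vec m, IsHadSupp t D fun i => g (z i) := fun g =>
      ⟨fun s _ => linear_comp_mem hz (g : Vec m →ₗ[ZMod 2] Vec m) s,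
        hD.2 (linear_comp_mem hz (g : Vec m →ₗ[ZMod 2] Vec m) t)⟩
    simp [h1, h2, h3]
  · have h1 : codeInd m D z = 0 := by simp [codeInd, hz]
    push Not at hz
    obtain ⟨s₀, hs₀⟩ := hz
    set r : Vec n := fun i => z i s₀ with hrdef
    simp only [h1, mul_zero, zero_add, sub_zero]
    have hadd : ∀ y, codeInd m (D ⊔ Submodule.span (ZMod 2) {y}) z ≠ 0 → r + y ∈ D ∧
        ∀ s, (fun i => z i s) ∈ D ⊔ Submodule.span (ZMod 2) {r} := by
      intro y hy
      have h2 : ∀ s, (fun i => z i s) ∈ D ⊔ Submodule.span (ZMod 2) {y} := by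
        by_contra h
        exact hy (by simp [codeInd, h])
      have h3 := add_mem_of_mem_sup hs₀ (h2 s₀)
      exact ⟨h3, by rwa [sup_span_eq_of_add_mem h3]⟩
    have hdual : ∀ {y}, y ∈ dualCode D → r + y ∈ D → r ∈ dualCode D := by
      intro y hy h
      have h1 := sub_mem (hD.2 h) hy
      rwa [add_sub_cancel_right] at h1
    by_cases hgood : r ∈ dualCode D ∧ ∀ s, (fun i => z i s) ∈ D ⊔ Submodule.span (ZMod 2) {r}
    · rw [Finset.sum_boole, card_filter_isHadSupp t hD hs₀ hgood.1 hgood.2, mul_comm]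
      congr 1
      -- The codes D + ⟨y⟩ containing all rows are those with y in the coset r + D.
      have h2 : ∑ y ∈ Finset.univ.filter (fun y => y ∈ dualCode D ∧ y ∉ D),
          codeInd m (D ⊔ Submodule.span (ZMod 2) {y}) z =
          ∑ y : Vec n, if r + y ∈ D then (1 : ℝ) else 0 := by
        rw [Finset.sum_filter]
        refine Finset.sum_congr rfl fun y _ => ?_
        by_cases hy : r + y ∈ D
        · have hyd : y ∈ dualCode D := by
            have h1 := sub_mem (hD.2 hy) hgood.1
            rwa [add_sub_cancel_left] at h1
          have hyn : y ∉ D := fun h => hs₀ ((D.add_mem_iff_left h).1 hy)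
          rw [if_pos ⟨hyd, hyn⟩, if_pos hy, ← sup_span_eq_of_add_mem hy, codeInd,
            if_pos hgood.2]
        · rw [if_neg hy]
          split_ifs
          · by_contra hne
            exact hy (hadd y hne).1
          · rfl
      have h3 : ∑ y : Vec n, (if r + y ∈ D then (1 : ℝ) else 0) =
          ∑ y : Vec n, if y ∈ D then (1 : ℝ) else 0 :=
        Equiv.sum_comp (Equiv.addLeft r) (fun y => if y ∈ D then (1 : ℝ) else 0)
      rw [h2, h3, Finset.sum_boole]
      have := card_code D
      rw [Nat.card_eq_fintype_card, Fintype.card_subtype] at this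
      rw [this]
      norm_cast
    · rw [Finset.sum_eq_zero, Finset.sum_eq_zero, mul_zero, mul_zero]
      · intro y hy
        by_contra hne
        obtain ⟨h2, h3⟩ := hadd y hne
        exact hgood ⟨hdual (Finset.mem_filter.1 hy).2.1 h2, h3⟩
      · intro g _
        refine if_neg fun hg => hgood ?_
        set y : Vec n := fun i => g (z i) t
        have h2 : ∀ s, (fun i => z i s) ∈ D ⊔ Submodule.span (ZMod 2) {y} := by
          refine rows_mem_of_map_rows_mem g fun s => ?_
          by_cases hs : s = t
          · subst hs
            exact (le_sup_right : _ ≤ D ⊔ Submodule.span (ZMod 2) {y})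
              (Submodule.mem_span_singleton_self y)
          · exact (le_sup_left : D ≤ _) (hg.1 s hs)
        have h3 := add_mem_of_mem_sup hs₀ (h2 s₀)
        exact ⟨hdual hg.2 h3, by rwa [sup_span_eq_of_add_mem h3]⟩

/-- The Hadamard operator at `t`, summed over all linear changes of coordinates. -/
noncomputable def avgHad {m : ℕ} (n : ℕ) (t : Fin m) :
    ((Fin n → Vec m) → ℝ) →ₗ[ℝ] ((Fin n → Vec m) → ℝ) :=
  ∑ g : Vec m ≃ₗ[ZMod 2] Vec m,
    (LinearMap.funLeft ℝ ℝ fun (z : Fin n → Vec m) i => g (z i)) ∘ₗ act n (hadAt t)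

theorem avgHad_apply {m n : ℕ} (t : Fin m) (a : (Fin n → Vec m) → ℝ) (z : Fin n → Vec m) :
    avgHad n t a z = ∑ g : Vec m ≃ₗ[ZMod 2] Vec m, act n (hadAt t) a fun i => g (z i) := by
  simp [avgHad, LinearMap.funLeft_apply]

theorem avgHad_of_gen {m n : ℕ} (t : Fin m) {a : (Fin n → Vec m) → ℝ}
    (ha : ∀ A : Matrix (Vec m) (Vec m) ℝ, Gen A → act n A a = a) :
    avgHad n t a = (Fintype.card (Vec m ≃ₗ[ZMod 2] Vec m) : ℝ) • a := by
  funext z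
  rw [avgHad_apply, ha _ (Gen.hadAt t)]
  have : ∀ g : Vec m ≃ₗ[ZMod 2] Vec m, a (fun i => g (z i)) = a z := by
    intro g
    have h := congrFun (ha _ (Gen.signedPerm _ _ (isAffine_linearEquiv g) (isQuad_const 0))) z
    rw [act_signedPerm] at h
    simpa [signR_zero] using h
  simp [this]

open Classical in
theorem avgHad_codeInd {m n : ℕ} (t : Fin m) {D : Submodule (ZMod 2) (Vec n)}
    (hD : IsSelfOrth D) :
    avgHad n t (codeInd m D) = (Real.sqrt 2)⁻¹ ^ n •
      ((2 ^ finrank (ZMod 2) D * (Fintype.card (Vec m ≃ₗ[ZMod 2] Vec m) : ℝ)) • codeInd m D +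
      (stabCard t : ℝ) • ∑ y ∈ Finset.univ.filter (fun y => y ∈ dualCode D ∧ y ∉ D),
        (codeInd m (D ⊔ Submodule.span (ZMod 2) {y}) - codeInd m D)) := by
  funext z
  rw [avgHad_apply]
  have h : ∀ g : Vec m ≃ₗ[ZMod 2] Vec m, act n (hadAt t) (codeInd m D) (fun i => g (z i)) =
      (Real.sqrt 2)⁻¹ ^ n * 2 ^ finrank (ZMod 2) D *
        if IsHadSupp t D (fun i => g (z i)) then 1 else 0 := by
    intro g
    rw [act_hadAt_codeInd]
    congr 1
    exact if_congr Iff.rfl rfl rfl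
  rw [Finset.sum_congr rfl fun g _ => h g, ← Finset.mul_sum, mul_assoc,
    card_mul_sum_isHadSupp t hD z]
  simp [Finset.sum_apply]

theorem card_dual_sdiff {n : ℕ} {D : Submodule (ZMod 2) (Vec n)} (hD : IsSelfOrth D)
    [DecidablePred fun y => y ∈ dualCode D ∧ y ∉ D] :
    ((Finset.univ.filter (fun y => y ∈ dualCode D ∧ y ∉ D)).card : ℝ) =
      2 ^ (n - finrank (ZMod 2) D) - 2 ^ finrank (ZMod 2) D := by
  classical
  have h1 := card_code D
  have h2 := card_code (dualCode D)
  rw [Nat.card_eq_fintype_card, Fintype.card_subtype] at h1 h2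
  have h3 : (Finset.univ.filter (fun y => y ∈ dualCode D ∧ y ∉ D)) =
      (Finset.univ.filter (fun y => y ∈ dualCode D)) \ (Finset.univ.filter (fun y => y ∈ D)) := by
    ext y; simp
  have h4 : (Finset.univ.filter (fun y => y ∈ D)) ⊆ Finset.univ.filter (fun y => y ∈ dualCode D) := by
    intro y hy
    simp only [Finset.mem_filter, Finset.mem_univ, true_and] at hy ⊢
    exact hD.2 hy
  have h5 := finrank_dualCode D
  have h6 : finrank (ZMod 2) (dualCode D) = n - finrank (ZMod 2) D := by omega
  rw [h3, Finset.cast_card_sdiff h4, h1, h2, h6]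
  push_cast
  rfl

/-- The span of the indicator functions of the self-orthogonal codes of dimension at least `j`. -/
noncomputable def codeSpan (m n j : ℕ) : Submodule ℝ ((Fin n → Vec m) → ℝ) :=
  Submodule.span ℝ (codeInd m '' {D | IsSelfOrth D ∧ j ≤ finrank (ZMod 2) D})

theorem codeInd_mem_codeSpan {m n j : ℕ} {D : Submodule (ZMod 2) (Vec n)} (hD : IsSelfOrth D)
    (hj : j ≤ finrank (ZMod 2) D) : codeInd m D ∈ codeSpan m n j :=
  Submodule.subset_span ⟨D, ⟨hD, hj⟩, rfl⟩

theorem codeSpan_anti {m n j j' : ℕ} (h : j ≤ j') : codeSpan m n j' ≤ codeSpan m n j :=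
  Submodule.span_mono (Set.image_mono fun _ hD => ⟨hD.1, h.trans hD.2⟩)

theorem isSelfOrth_sup {n : ℕ} {D : Submodule (ZMod 2) (Vec n)} (hD : IsSelfOrth D) {y : Vec n}
    (hy : y ∈ dualCode D) : IsSelfOrth (D ⊔ Submodule.span (ZMod 2) {y}) := by
  refine ⟨(le_sup_left : D ≤ _) hD.1, ?_⟩
  -- The all-ones word lies in D, so y·y = y·1 = 0: any dual word may be adjoined.
  have hyy : y ⬝ᵥ y = 0 := by
    rw [← hy 1 hD.1]
    refine Finset.sum_congr rfl fun i _ => ?_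
    change y i * y i = y i * 1
    generalize y i = a
    revert a; decide
  intro v hv w hw
  obtain ⟨r, hr⟩ := mem_sup_singleton_iff.1 hv
  obtain ⟨q, hq⟩ := mem_sup_singleton_iff.1 hw
  obtain ⟨d, hd, rfl⟩ : ∃ d ∈ D, v = d + r • y :=
    ⟨_, hr, by rw [add_assoc, vec_add_self, add_zero]⟩
  obtain ⟨e, he, rfl⟩ : ∃ e ∈ D, w = e + q • y :=
    ⟨_, hq, by rw [add_assoc, vec_add_self, add_zero]⟩
  rw [add_dotProduct, dotProduct_add, dotProduct_add, hD.2 hd _ he, dotProduct_smul,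
    smul_dotProduct, smul_dotProduct, dotProduct_smul, dotProduct_comm d y, hy _ hd,
    hy _ he, hyy]
  simp

theorem finrank_lt_sup {n : ℕ} {D : Submodule (ZMod 2) (Vec n)} {y : Vec n} (hy : y ∉ D) :
    finrank (ZMod 2) D < finrank (ZMod 2) (D ⊔ Submodule.span (ZMod 2) {y} : Submodule _ _) := by
  refine Submodule.finrank_lt_finrank_of_lt (lt_of_le_of_ne le_sup_left fun h => hy ?_)
  rw [h]
  exact (le_sup_right : _ ≤ D ⊔ Submodule.span (ZMod 2) {y}) (Submodule.mem_span_singleton_self y)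

/-- The diagonal coefficient of `avgHad` at a self-orthogonal code of dimension `j`. -/
noncomputable def diagCoeff {m : ℕ} (n : ℕ) (t : Fin m) (j : ℕ) : ℝ :=
  (Real.sqrt 2)⁻¹ ^ n * (2 ^ j * (Fintype.card (Vec m ≃ₗ[ZMod 2] Vec m) : ℝ) -
    stabCard t * (2 ^ (n - j) - 2 ^ j))

theorem avgHad_codeInd_sub_mem {m n : ℕ} (t : Fin m) {D : Submodule (ZMod 2) (Vec n)}
    (hD : IsSelfOrth D) :
    avgHad n t (codeInd m D) - diagCoeff n t (finrank (ZMod 2) D) • codeInd m D ∈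
      codeSpan m n (finrank (ZMod 2) D + 1) := by
  classical
  have : avgHad n t (codeInd m D) - diagCoeff n t (finrank (ZMod 2) D) • codeInd m D =
      ((Real.sqrt 2)⁻¹ ^ n * (stabCard t : ℝ)) •
        ∑ y ∈ Finset.univ.filter (fun y => y ∈ dualCode D ∧ y ∉ D),
          codeInd m (D ⊔ Submodule.span (ZMod 2) {y}) := by
    rw [avgHad_codeInd t hD, diagCoeff, ← card_dual_sdiff hD, Finset.sum_sub_distrib,
      Finset.sum_const, ← Nat.cast_smul_eq_nsmul ℝ]
    module
  rw [this]
  refine Submodule.smul_mem _ _ (sum_mem fun y hy => ?_)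
  obtain ⟨h1, h2⟩ := (Finset.mem_filter.1 hy).2
  exact codeInd_mem_codeSpan (isSelfOrth_sup hD h1) (finrank_lt_sup h2)

/-- The subtracted term is nonnegative, so the coefficient is at most 2^{j-k}|GL|, which is below
|GL| when j < k. -/
theorem diagCoeff_ne {m k j : ℕ} (t : Fin m) (hj : j < k) :
    diagCoeff (2 * k) t j ≠ Fintype.card (Vec m ≃ₗ[ZMod 2] Vec m) := by
  have hG : (0 : ℝ) < Fintype.card (Vec m ≃ₗ[ZMod 2] Vec m) := by
    exact_mod_cast Fintype.card_pos_iff.2 ⟨LinearEquiv.refl _ _⟩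
  have hs : (Real.sqrt 2)⁻¹ ^ (2 * k) * (2 : ℝ) ^ k = 1 := by
    rw [pow_mul, inv_pow, Real.sq_sqrt (by norm_num), inv_pow, inv_mul_cancel₀ (by positivity)]
  have h0 : (0 : ℝ) < (Real.sqrt 2)⁻¹ ^ (2 * k) := by positivity
  have h1 : (2 : ℝ) ^ j ≤ 2 ^ (2 * k - j) := pow_le_pow_right₀ (by norm_num) (by omega)
  have h2 : (2 : ℝ) ^ j < 2 ^ k := pow_lt_pow_right₀ (by norm_num) hj
  have hK : (0 : ℝ) ≤ stabCard t * (2 ^ (2 * k - j) - 2 ^ j) :=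
    mul_nonneg (Nat.cast_nonneg _) (sub_nonneg.2 h1)
  apply ne_of_lt
  calc diagCoeff (2 * k) t j
      ≤ (Real.sqrt 2)⁻¹ ^ (2 * k) * (2 ^ j * (Fintype.card (Vec m ≃ₗ[ZMod 2] Vec m) : ℝ)) :=
        mul_le_mul_of_nonneg_left (by linarith) h0.le
    _ < (Real.sqrt 2)⁻¹ ^ (2 * k) * (2 ^ k * (Fintype.card (Vec m ≃ₗ[ZMod 2] Vec m) : ℝ)) :=
        mul_lt_mul_of_pos_left (mul_lt_mul_of_pos_right h2 hG) h0
    _ = _ := by rw [← mul_assoc, hs, one_mul]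

theorem avgHad_sub_mem {m n j : ℕ} (t : Fin m) {a : (Fin n → Vec m) → ℝ}
    (ha : a ∈ codeSpan m n j) : avgHad n t a - diagCoeff n t j • a ∈ codeSpan m n (j + 1) := by
  refine Submodule.span_induction
    (p := fun a _ => avgHad n t a - diagCoeff n t j • a ∈ codeSpan m n (j + 1)) ?_ ?_ ?_ ?_ ha
  · rintro _ ⟨D, ⟨hD, hj⟩, rfl⟩
    have h := avgHad_codeInd_sub_mem (m := m) t hD
    rcases hj.eq_or_lt with rfl | hlt
    · exact h
    · have h1 := codeInd_mem_codeSpan (m := m) hD (Nat.succ_le_of_lt hlt)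
      have h2 := codeSpan_anti (m := m) (n := n) (show j + 1 ≤ finrank (ZMod 2) D + 1 by omega) h
      have h3 : avgHad n t (codeInd m D) ∈ codeSpan m n (j + 1) := by
        have := add_mem h2 (Submodule.smul_mem _ (diagCoeff n t (finrank (ZMod 2) D)) h1)
        rwa [sub_add_cancel] at this
      exact sub_mem h3 (Submodule.smul_mem _ _ h1)
  · simp
  · intro x y _ _ hx hy
    rw [map_add, smul_add, add_sub_add_comm]
    exact add_mem hx hy
  · intro r x _ hx
    rw [map_smul, smul_comm, ← smul_sub]
    exact Submodule.smul_mem _ r hx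

/-- An invariant has eigenvalue |GL| under `avgHad`, while modulo codes of dimension above j the
operator is the scalar `diagCoeff`. As the scalars differ for j < k, the invariant lies in the next
span. -/
theorem mem_codeSpan_of_gen {m k : ℕ} (hm : 1 ≤ m) {a : (Fin (2 * k) → Vec m) → ℝ}
    (ha : ∀ A : Matrix (Vec m) (Vec m) ℝ, Gen A → act (2 * k) A a = a) :
    a ∈ codeSpan m (2 * k) k := by
  have key : ∀ j ≤ k, a ∈ codeSpan m (2 * k) j := by
    intro j
    induction j with
    | zero =>
      intro _
      have h := mem_span_codeInd (n := 2 * k) (by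
        rw [Nat.cast_mul, show ((2 : ℕ) : ZMod 2) = 0 by decide, zero_mul]) ha
      refine Submodule.span_mono (Set.image_mono fun D hD => ?_) h
      exact ⟨hD, Nat.zero_le _⟩
    | succ j ih =>
      intro hj
      have h := avgHad_sub_mem ⟨0, hm⟩ (ih (by omega))
      rw [avgHad_of_gen _ ha, ← sub_smul] at h
      exact (Submodule.smul_mem_iff _ (sub_ne_zero.2 (diagCoeff_ne _ hj).symm)).1 h
  exact key k le_rfl

theorem isSelfDual_of_finrank {k : ℕ} {D : Submodule (ZMod 2) (Vec (2 * k))} (hD : IsSelfOrth D)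
    (hk : k ≤ finrank (ZMod 2) D) : IsSelfDual D := by
  rw [isSelfDual_iff]
  have := finrank_dualCode D
  exact (Submodule.eq_of_le_of_finrank_le hD.2 (by omega)).symm

/-! ### Symmetric tensors and homogeneous polynomials. -/

/-- The exponent vector of the monomial `∏ i, x_{z i}`. -/
noncomputable def content {m n : ℕ} (z : Fin n → Vec m) : Vec m →₀ ℕ :=
  ∑ i, Finsupp.single (z i) 1

theorem prod_X_eq {m n : ℕ} (z : Fin n → Vec m) :
    ∏ i, (X (z i) : MvPolynomial (Vec m) ℝ) = monomial (content z) 1 := by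
  rw [content, monomial_sum_one]
  rfl

theorem coeff_poly {m n : ℕ} (a : (Fin n → Vec m) → ℝ) (s : Vec m →₀ ℕ)
    [DecidableEq (Vec m →₀ ℕ)] :
    coeff s (poly a) = ∑ z ∈ Finset.univ.filter (fun z : Fin n → Vec m => content z = s), a z := by
  rw [poly_apply, coeff_sum, Finset.sum_filter]
  refine Finset.sum_congr rfl fun z _ => ?_
  rw [prod_X_eq, coeff_smul, coeff_monomial]
  by_cases h : content z = s <;> simp [h]

theorem content_comp_perm {m n : ℕ} (z : Fin n → Vec m) (σ : Equiv.Perm (Fin n)) :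
    content (z ∘ σ) = content z :=
  Equiv.sum_comp σ fun i => Finsupp.single (z i) 1

theorem exists_perm_of_content_eq {m n : ℕ} {z z' : Fin n → Vec m} (h : content z = content z') :
    ∃ σ : Equiv.Perm (Fin n), z' ∘ σ = z := by
  have hc : ∀ (z : Fin n → Vec m) v, content z v = Fintype.card {i // z i = v} := by
    intro z v
    rw [content, Finsupp.finsetSum_apply, Fintype.card_subtype, Finset.card_filter]
    exact Finset.sum_congr rfl fun i _ => by rw [Finsupp.single_apply]
  have he : ∀ v, Nonempty ({i // z i = v} ≃ {i // z' i = v}) := fun v =>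
    Fintype.card_eq.1 (by rw [← hc, ← hc, h])
  exact ⟨Equiv.ofFiberEquiv fun v => (he v).some,
    funext fun i => Equiv.ofFiberEquiv_map (fun v => (he v).some) i⟩

theorem exists_content_eq {m n : ℕ} (s : Vec m →₀ ℕ) (hs : s.degree = n) :
    ∃ z : Fin n → Vec m, content z = s := by
  induction n generalizing s with
  | zero => exact ⟨fun i => i.elim0, by simp [content, (Finsupp.degree_eq_zero_iff s).1 hs]⟩
  | succ n ih =>
    have hne : s ≠ 0 := by
      rintro rfl
      simp at hs
    obtain ⟨v, hv⟩ := Finsupp.ne_iff.1 hne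
    have hle : Finsupp.single v 1 ≤ s := by
      rw [Finsupp.single_le_iff]
      exact Nat.one_le_iff_ne_zero.2 hv
    have hadd : Finsupp.single v 1 + (s - Finsupp.single v 1) = s := add_tsub_cancel_of_le hle
    obtain ⟨z, hz⟩ := ih (s - Finsupp.single v 1) (by
      have := congrArg Finsupp.degree hadd
      rw [map_add, Finsupp.degree_single, hs] at this
      omega)
    refine ⟨Fin.cons v z, ?_⟩
    rw [content, Fin.sum_univ_succ]
    simp only [Fin.cons_zero, Fin.cons_succ]
    rw [← content, hz, hadd]

/-- Symmetric tensors are determined by their polynomials. -/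
theorem eq_of_poly_eq {m n : ℕ} {a a' : (Fin n → Vec m) → ℝ}
    (ha : ∀ (σ : Equiv.Perm (Fin n)) z, a (z ∘ σ) = a z)
    (ha' : ∀ (σ : Equiv.Perm (Fin n)) z, a' (z ∘ σ) = a' z) (h : poly a = poly a') : a = a' := by
  classical
  have key : ∀ a : (Fin n → Vec m) → ℝ, (∀ (σ : Equiv.Perm (Fin n)) z, a (z ∘ σ) = a z) →
      ∀ z, coeff (content z) (poly a) =
        (Finset.univ.filter fun w : Fin n → Vec m => content w = content z).card * a z := by
    intro a ha z
    rw [coeff_poly, ← nsmul_eq_mul, ← Finset.sum_const]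
    refine Finset.sum_congr rfl fun w hw => ?_
    obtain ⟨σ, rfl⟩ := exists_perm_of_content_eq (Finset.mem_filter.1 hw).2
    exact ha σ z
  funext z
  have h1 := key a ha z
  rw [h, key a' ha' z] at h1
  have hpos : ((Finset.univ.filter fun w : Fin n → Vec m => content w = content z).card : ℝ) ≠ 0 := by
    rw [Nat.cast_ne_zero, ← Nat.pos_iff_ne_zero, Finset.card_pos]
    exact ⟨z, by simp⟩
  exact (mul_left_cancel₀ hpos h1).symm

theorem exists_symm_poly_eq {m n : ℕ} {p : MvPolynomial (Vec m) ℝ} (hp : p.IsHomogeneous n) :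
    ∃ a : (Fin n → Vec m) → ℝ, (∀ (σ : Equiv.Perm (Fin n)) z, a (z ∘ σ) = a z) ∧ poly a = p := by
  classical
  let N : (Vec m →₀ ℕ) → ℝ := fun s =>
    (Finset.univ.filter fun w : Fin n → Vec m => content w = s).card
  -- Each coefficient is shared equally among the words having that monomial.
  refine ⟨fun z => coeff (content z) p / N (content z), fun σ z => by
    simp only [content_comp_perm], ?_⟩
  ext s
  rw [coeff_poly]
  have h1 : ∀ z ∈ Finset.univ.filter (fun z : Fin n → Vec m => content z = s),
      coeff (content z) p / N (content z) = coeff s p / N s := by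
    intro z hz
    rw [(Finset.mem_filter.1 hz).2]
  rw [Finset.sum_congr rfl h1, Finset.sum_const, nsmul_eq_mul]
  by_cases hs : coeff s p = 0
  · simp [hs]
  · have hdeg : s.degree = n := by
      by_contra hne
      exact hs (hp.coeff_eq_zero hne)
    obtain ⟨z, hz⟩ := exists_content_eq s hdeg
    have hpos : N s ≠ 0 := by
      simp only [N]
      rw [Nat.cast_ne_zero, ← Nat.pos_iff_ne_zero, Finset.card_pos]
      exact ⟨z, by simp [hz]⟩
    exact mul_div_cancel₀ _ hpos

theorem act_symm {m n : ℕ} (A : Matrix (Vec m) (Vec m) ℝ) {a : (Fin n → Vec m) → ℝ}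
    (ha : ∀ (σ : Equiv.Perm (Fin n)) z, a (z ∘ σ) = a z) (σ : Equiv.Perm (Fin n))
    (z : Fin n → Vec m) : act n A a (z ∘ σ) = act n A a z := by
  rw [act_apply, act_apply, ← (Equiv.arrowCongr σ.symm (Equiv.refl (Vec m))).sum_comp]
  refine Finset.sum_congr rfl fun w _ => ?_
  have h : (Equiv.arrowCongr σ.symm (Equiv.refl (Vec m))) w = w ∘ σ := by
    funext i; simp [Equiv.arrowCongr]
  rw [h, ha]
  congr 1
  exact Equiv.prod_comp σ fun i => A (w i) (z i)

/-- The symmetric tensor of p is unique and the action preserves symmetry, so invariance of p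
becomes invariance of the tensor. -/
theorem homogeneousInvariants_le {m k : ℕ} (hm : 1 ≤ m)
    (b : Basis (Fin m) (ZMod 2) (GaloisField 2 m)) :
    homogeneousInvariants m (2 * k) ≤
      Submodule.span ℝ (Set.range fun D : SelfDualCode (2 * k) => cwe b D) := by
  intro p hp
  rw [mem_homogeneousInvariants_iff] at hp
  obtain ⟨a, hsymm, rfl⟩ := exists_symm_poly_eq hp.1
  have ha : a ∈ codeSpan m (2 * k) k := by
    refine mem_codeSpan_of_gen hm fun A hA => ?_
    refine eq_of_poly_eq (act_symm A hsymm) hsymm ?_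
    rw [← subst_poly, hp.2 A hA.isClifford]
  have h := Submodule.mem_map_of_mem (f := poly) ha
  rw [codeSpan, Submodule.map_span] at h
  refine Submodule.span_mono ?_ h
  rintro _ ⟨_, ⟨D, ⟨hD, hk⟩, rfl⟩, rfl⟩
  exact ⟨⟨D, isSelfDual_of_finrank hD hk⟩, cwe_eq b _⟩

theorem span_cwe_eq {m k : ℕ} (hm : 1 ≤ m) (b : Basis (Fin m) (ZMod 2) (GaloisField 2 m)) :
    Submodule.span ℝ (Set.range fun D : SelfDualCode (2 * k) => cwe b D) =
      homogeneousInvariants m (2 * k) := by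
  refine le_antisymm ?_ (homogeneousInvariants_le hm b)
  rw [Submodule.span_le, Set.range_subset_iff]
  exact cwe_mem b

/-! ### Linear independence for k ≤ m + 1. -/

theorem exists_genCode_eq {m n : ℕ} {D : Submodule (ZMod 2) (Vec n)} (h1 : (1 : Vec n) ∈ D)
    (hD : finrank (ZMod 2) D ≤ m + 1) : ∃ z : Fin n → Vec m, genCode z = D := by
  let S : Submodule (ZMod 2) (Vec n) := Submodule.span (ZMod 2) {1}
  have hSD : S ≤ D := by rwa [Submodule.span_singleton_le_iff_mem]
  obtain ⟨Q, hQ⟩ := Submodule.exists_isCompl (Submodule.comap D.subtype S)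
  have hSQ : S ⊔ Q.map D.subtype = D := by
    have h := congrArg (Submodule.map D.subtype) hQ.sup_eq_top
    rw [Submodule.map_sup, Submodule.map_comap_subtype, inf_eq_right.2 hSD, Submodule.map_top,
      Submodule.range_subtype] at h
    exact h
  -- The all-ones word accounts for one dimension, so m further rows suffice up to dimension m + 1.
  -- In length 0 that word is zero and the whole space is trivial.
  have hQm : finrank (ZMod 2) Q ≤ m := by
    have h := Submodule.finrank_add_eq_of_isCompl hQ
    by_cases hn : (1 : Vec n) = 0
    · have : Subsingleton (Vec n) := ⟨fun v w => by
        rw [← mul_one v, ← mul_one w, hn, mul_zero, mul_zero]⟩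
      have : finrank (ZMod 2) Q = 0 := finrank_zero_of_subsingleton
      omega
    · have : 0 < finrank (ZMod 2) (Submodule.comap D.subtype S) := by
        have : Nontrivial (Submodule.comap D.subtype S) :=
          ⟨⟨⟨⟨1, h1⟩, Submodule.mem_span_singleton_self _⟩, 0, fun h => hn (by
            have := congrArg
              (fun x : Submodule.comap D.subtype S => ((x : D) : Vec n)) h
            simpa using this)⟩⟩
        exact finrank_pos
      omega
  let e := finBasis (ZMod 2) Q
  let row : Fin m → Vec n := fun t =>
    if h : (t : ℕ) < finrank (ZMod 2) Q then ((e ⟨t, h⟩ : D) : Vec n) else 0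
  refine ⟨fun i t => row t i, le_antisymm (genCode_le_iff.2 ⟨h1, fun t => ?_⟩) ?_⟩
  · change row t ∈ D
    simp only [row]
    split_ifs
    · exact Subtype.property _
    · exact zero_mem _
  · have hrow : ∀ t, row t ∈ genCode (fun i t => row t i) := fun t =>
      row_mem_genCode (fun i t => row t i) t
    conv_lhs => rw [← hSQ]
    refine sup_le ?_ ?_
    · rw [Submodule.span_singleton_le_iff_mem]
      exact one_mem_genCode _
    · rintro _ ⟨q, hq, rfl⟩
      have h := e.sum_repr ⟨q, hq⟩
      have h' := congrArg (fun x : Q => ((x : D) : Vec n)) h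
      simp only [Submodule.coe_sum, Submodule.coe_smul] at h'
      change (q : Vec n) ∈ _
      rw [← h']
      refine sum_mem fun j _ => Submodule.smul_mem _ _ ?_
      have h2 := hrow ⟨j, j.2.trans_le hQm⟩
      simpa [row, j.2] using h2

theorem eq_of_le_of_isSelfDual {n : ℕ} {D E : Submodule (ZMod 2) (Vec n)} (hD : IsSelfDual D)
    (hE : IsSelfDual E) (h : D ≤ E) : D = E := by
  refine le_antisymm h ?_
  have := dualCode_anti h
  rwa [isSelfDual_iff.1 hD, isSelfDual_iff.1 hE] at this

theorem cwe_eq_of_equiv {m n : ℕ} (b : Basis (Fin m) (ZMod 2) (GaloisField 2 m))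
    {D E : SelfDualCode n} (h : (codeSetoid n).r D E) : cwe b D = cwe b E := by
  classical
  obtain ⟨σ, h⟩ := h
  rw [cwe_eq, cwe_eq, poly_apply, poly_apply,
    ← (Equiv.arrowCongr σ.symm (Equiv.refl (Vec m))).sum_comp]
  refine Finset.sum_congr rfl fun z _ => ?_
  have hz : (Equiv.arrowCongr σ.symm (Equiv.refl (Vec m))) z = z ∘ σ := by
    funext i; simp [Equiv.arrowCongr]
  rw [hz]
  congr 1
  · refine if_congr (forall_congr' fun t => ?_) rfl rfl
    exact (h fun i => z i t).symm
  · exact Equiv.prod_comp σ fun i => (X (z i) : MvPolynomial (Vec m) ℝ)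

/-- All terms are nonnegative, so the coefficient is nonzero exactly when some rearrangement of z
has its rows in E. Then D lies in a permuted copy of E, and self-duality turns inclusion into
equality. -/
theorem coeff_cwe_ne_zero_iff {m n : ℕ} (b : Basis (Fin m) (ZMod 2) (GaloisField 2 m))
    {D E : SelfDualCode n} {z : Fin n → Vec m} (hz : genCode z = D.1) :
    coeff (content z) (cwe b E) ≠ 0 ↔ (codeSetoid n).r E D := by
  classical
  rw [cwe_eq, coeff_poly]
  have hmem : ∀ t, (fun i => z i t) ∈ D.1 := fun t => hz ▸ row_mem_genCode z t
  constructor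
  · intro h
    obtain ⟨w, hw, hne⟩ := Finset.exists_ne_zero_of_sum_ne_zero h
    obtain ⟨σ, rfl⟩ := exists_perm_of_content_eq (Finset.mem_filter.1 hw).2
    have hrows : ∀ t, (fun i => (z ∘ σ) i t) ∈ E.1 := by
      by_contra hcon
      exact hne (if_neg hcon)
    let L : Vec n ≃ₗ[ZMod 2] Vec n := LinearEquiv.funCongrLeft (ZMod 2) (ZMod 2) σ
    have hL : ∀ v, L v = v ∘ σ := fun v => rfl
    have hle : D.1 ≤ E.1.comap (L : Vec n →ₗ[ZMod 2] Vec n) := by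
      rw [← hz]
      exact genCode_le_iff.2 ⟨one_mem_of_isSelfDual (D := E.1) E.2, hrows⟩
    have hdual : IsSelfDual (E.1.comap (L : Vec n →ₗ[ZMod 2] Vec n)) := by
      intro v
      change v ∘ σ ∈ E.1 ↔ _
      rw [E.2]
      constructor
      · intro h w hw
        rw [← h (w ∘ σ) hw]
        exact (Equiv.sum_comp σ fun i => v i * w i).symm
      · intro h w hw
        have h1 := h (w ∘ σ.symm) (by
          change (w ∘ σ.symm) ∘ σ ∈ E.1
          rwa [Function.comp_assoc, Equiv.symm_comp_self, Function.comp_id])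
        rw [← h1]
        simp only [dotProduct]
        rw [← Equiv.sum_comp σ fun i => v i * (w ∘ σ.symm) i]
        simp
    have heq := eq_of_le_of_isSelfDual D.2 hdual hle
    exact ⟨σ, fun v => by rw [heq]; rfl⟩
  · rintro ⟨σ, h⟩
    refine ne_of_gt (Finset.sum_pos' (fun w _ => ?_) ⟨z ∘ σ, ?_, ?_⟩)
    · rw [codeInd]
      split_ifs <;> norm_num
    · simp [content_comp_perm]
    · rw [codeInd, if_pos]
      · norm_num
      · intro t
        exact (h fun i => z i t).1 (hmem t)

theorem exists_basis {m k : ℕ} (hm : 1 ≤ m) (hk : k ≤ m + 1)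
    (b : Basis (Fin m) (ZMod 2) (GaloisField 2 m)) :
    ∃ B : Basis (Quotient (codeSetoid (2 * k))) ℝ (homogeneousInvariants m (2 * k)),
      ∀ D : SelfDualCode (2 * k),
        (B (Quotient.mk (codeSetoid (2 * k)) D) : MvPolynomial (Vec m) ℝ) = cwe b D := by
  let v : Quotient (codeSetoid (2 * k)) → homogeneousInvariants m (2 * k) :=
    Quotient.lift (fun D => ⟨cwe b D, cwe_mem b D⟩) fun D E h => Subtype.ext (cwe_eq_of_equiv b h)
  have hv : ∀ D, (v (Quotient.mk _ D) : MvPolynomial (Vec m) ℝ) = cwe b D := fun D => rfl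
  have hword : ∀ D : SelfDualCode (2 * k), ∃ z : Fin (2 * k) → Vec m, genCode z = D.1 := by
    intro D
    refine exists_genCode_eq (one_mem_of_isSelfDual D.2) ?_
    have := finrank_dualCode D.1
    rw [isSelfDual_iff.1 D.2] at this
    omega
  choose z hz using hword
  have hli : LinearIndependent ℝ v := by
    rw [linearIndependent_iff']
    intro s g hg q hq
    have h1 := congrArg (fun x : homogeneousInvariants m (2 * k) =>
      coeff (content (z q.out)) (x : MvPolynomial (Vec m) ℝ)) hg
    simp only [Submodule.coe_sum, Submodule.coe_smul, coeff_sum, coeff_smul, Submodule.coe_zero,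
      coeff_zero] at h1
    -- The matrix of coefficients at the monomials of generating words is diagonal with nonzero
    -- diagonal.
    have hco : ∀ q', coeff (content (z q.out)) (v q' : MvPolynomial (Vec m) ℝ) ≠ 0 ↔ q' = q := by
      intro q'
      conv_lhs => rw [← q'.out_eq]
      rw [hv, coeff_cwe_ne_zero_iff b (hz q.out)]
      conv_rhs => rw [← q'.out_eq, ← q.out_eq]
      exact Quotient.eq.symm
    rw [Finset.sum_eq_single q] at h1
    · exact (mul_eq_zero.1 h1).resolve_right ((hco q).2 rfl)
    · intro q' _ hne
      rw [not_not.1 (mt (hco q').1 hne), smul_zero]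
    · exact fun h => absurd hq h
  have hspan : ⊤ ≤ Submodule.span ℝ (Set.range v) := by
    rintro ⟨p, hp⟩ -
    have hinj := Submodule.subtype_injective (homogeneousInvariants m (2 * k))
    rw [← Submodule.comap_map_eq_of_injective hinj (Submodule.span ℝ (Set.range v)),
      Submodule.mem_comap, Submodule.map_span]
    refine Submodule.span_mono ?_ (homogeneousInvariants_le hm b hp)
    rintro _ ⟨D, rfl⟩
    exact ⟨v (Quotient.mk _ D), ⟨_, rfl⟩, rfl⟩
  exact ⟨Basis.mk hli hspan, fun D => by rw [Basis.mk_apply, hv]⟩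

end CliffordInvariants

theorem theorem2 (k m : ℕ) (hm : 1 ≤ m)
    (b : Module.Basis (Fin m) (ZMod 2) (GaloisField 2 m)) :
    Submodule.span ℝ
        (Set.range fun D : CliffordInvariants.SelfDualCode (2 * k) => CliffordInvariants.cwe b D)
      = CliffordInvariants.homogeneousInvariants m (2 * k) ∧
    (k ≤ m + 1 →
      ∃ B : Module.Basis (Quotient (CliffordInvariants.codeSetoid (2 * k))) ℝ
          (CliffordInvariants.homogeneousInvariants m (2 * k)),
        ∀ D : CliffordInvariants.SelfDualCode (2 * k),
          (B (Quotient.mk (CliffordInvariants.codeSetoid (2 * k)) D) :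
            MvPolynomial (Fin m → ZMod 2) ℝ) = CliffordInvariants.cwe b D) :=
  ⟨CliffordInvariants.span_cwe_eq hm b, fun hk => CliffordInvariants.exists_basis hm hk b⟩
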